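/- Conventions. All Banach spaces are real, all manifolds are $C^\infty$ manifolds without boundary modelled on Banach spaces, and all maps are $C^\infty$. A submanifold $S\subseteq M$ is an embedded submanifold that is, in suitable charts of $M$, a closed complemented subspace of the model space. A pair $(M,M_0)$ consists of a Banach manifold $M$ and a closed embedded submanifold $M_0\hookrightarrow M$ modelled on a closed complemented subspace $E_0$ of the model space $E$ of $M$; its normal bundle is $\nu(M,M_0)=TM|_{M_0}/TM_0$, with its usual structure of a smooth vector bundle over $M_0$. A map of pairs $(f,f_0):(M,M_0)\to(N,N_0)$ is a smooth map $f:M\to N$ that restricts to a smooth map $f_0:M_0\to N_0$; it induces $f_*:\nu(M,M_0)\to\nu(N,N_0)$, $[X]\mapsto[Df(X)]$. A map $f:M\to N$ is transverse to a submanifold $S\subseteq N$ if for every $x\in f^{-1}(S)$ one has $Df_x(T_xM)+T_{f(x)}S=T_{f(x)}N$, and $Df_x^{-1}(T_{f(x)}S)$ is closed and complemented in $T_xM$. A submanifold $Z\subseteq N$ is transverse to $N_0$ if the inclusion $N_0\hookrightarrow N$ is transverse to $Z$. **Proposition.** Let $(f,f_0):(M,M_0)\to(N,N_0)$ be a map of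 pairs of Banach manifolds, let $Z\subseteq N$ be a submanifold transverse to $N_0$, and put $Z_0:=Z\cap N_0$. Suppose that $f$ is transverse to $Z$ and that $f_0$ is transverse to $Z_0$. Then $Z_0\subseteq N_0$, $f^{-1}(Z)\subseteq M$ and $f_0^{-1}(Z_0)\subseteq M_0$ are submanifolds; the canonical maps $$\nu(Z,Z_0)=TZ|_{Z_0}/TZ_0\to\nu(N,N_0),\qquad \nu(f^{-1}(Z),f_0^{-1}(Z_0))\to\nu(M,M_0)$$ are injective, and their images, with which we identify their domains, are submanifolds; the map $f_*:\nu(M,M_0)\to\nu(N,N_0)$ is smooth and transverse to $\nu(Z,Z_0)$; and $$f_*^{-1}(\nu(Z,Z_0))=\nu(f^{-1}(Z),f_0^{-1}(Z_0)).$$ **Corollary.** If $f:M\to N$ is a smooth map of Banach manifolds that is transverse to a submanifold $Z\subseteq N$, then $f^{-1}(Z)$ is a submanifold of $M$, $TZ$ is a submanifold of $TN$, the map $Df:TM\to TN$ is transverse to $TZ$, and $Df^{-1}(TZ)=T(f^{-1}(Z))$. -/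

import Mathlib

open Set Function Topology Bundle
open scoped Manifold ContDiff

set_option linter.unusedSectionVars false

noncomputable section

/-! ### Submanifolds, tangent spaces and transversality -/

section Submanifolds

variable {E : Type*} [NormedAddCommGroup E] [NormedSpace ℝ E]
  {H : Type*} [TopologicalSpace H] (I : ModelWithCorners ℝ E H)
  {M : Type*} [TopologicalSpace M] [ChartedSpace H M]
  {E' : Type*} [NormedAddCommGroup E'] [NormedSpace ℝ E']
  {H' : Type*} [TopologicalSpace H'] (J : ModelWithCorners ℝ E' H')
  {N : Type*} [TopologicalSpace N] [ChartedSpace H' N]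

/-- `S` is a smooth (embedded, split) submanifold of the manifold `M`: around each of its points
there is a chart of `M` that carries `S` to a closed complemented subspace of the model space.
The subspace may depend on the point. -/
def IsSubmanifold (S : Set M) : Prop :=
  ∀ x ∈ S, ∃ φ ∈ IsManifold.maximalAtlas I ∞ M, x ∈ φ.source ∧
    ∃ V : Submodule ℝ E, V.ClosedComplemented ∧ ∀ y ∈ φ.source, (y ∈ S ↔ φ.extend I y ∈ V)

/-- The tangent space at `x` of a submanifold `S ⊆ M`, as a subspace of `T_x M`: the velocity
vectors at time `0` of smooth curves through `x` that stay in `S`. (For a submanifold these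
vectors already form a subspace.) -/
def tangentSub (S : Set M) (x : M) : Submodule ℝ (TangentSpace I x) :=
  Submodule.span ℝ {v : TangentSpace I x | ∃ (γ : ℝ → M) (h : γ 0 = x),
    ContMDiffAt 𝓘(ℝ, ℝ) I ∞ γ 0 ∧ (∀ᶠ t in 𝓝 (0 : ℝ), γ t ∈ S) ∧
      v = h ▸ mfderiv 𝓘(ℝ, ℝ) I γ 0 (1 : ℝ)}

/-- The smooth map `f : M → N` is transverse to the submanifold `S ⊆ N`: whenever `f x ∈ S`, one
has `Df_x(T_x M) + T_{f x} S = T_{f x} N`, and `Df_x⁻¹(T_{f x} S)` is closed and complemented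
in `T_x M`. -/
def IsTransverse (f : M → N) (S : Set N) : Prop :=
  ∀ x, f x ∈ S →
    (mfderiv I J f x).range ⊔ tangentSub J S (f x) = ⊤ ∧
    ((tangentSub J S (f x)).comap (mfderiv I J f x).toLinearMap).ClosedComplemented

/-- The tangent bundle `TS` of a submanifold `S ⊆ M`, as a subset of `TM`. -/
def tangentSubset (S : Set M) : Set (TangentBundle I M) :=
  {p | p.1 ∈ S ∧ p.2 ∈ tangentSub I S p.1}

end Submanifolds

/-! ### Pairs of Banach manifolds -/

/-- A pair of Banach manifolds `(M, M₀)`: a closed embedding `M₀ → M` that in suitable charts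
around each point is the inclusion `E₀ → E₀ × F ≃ E` of a closed complemented subspace. -/
structure BanachPair (E₀ F E M₀ M : Type*)
    [NormedAddCommGroup E₀] [NormedSpace ℝ E₀] [NormedAddCommGroup F] [NormedSpace ℝ F]
    [NormedAddCommGroup E] [NormedSpace ℝ E]
    [TopologicalSpace M₀] [ChartedSpace E₀ M₀] [TopologicalSpace M] [ChartedSpace E M] where
  incl : M₀ → M
  isImmersion : Manifold.IsImmersionOfComplement F 𝓘(ℝ, E₀) 𝓘(ℝ, E) ∞ incl
  isClosedEmbedding : IsClosedEmbedding incl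

section ChartDerivatives

variable {E : Type*} [NormedAddCommGroup E] [NormedSpace ℝ E]
  {M : Type*} [TopologicalSpace M] [ChartedSpace E M] [IsManifold 𝓘(ℝ, E) ∞ M]

/-- The derivative at `p` of a chart, as a map `T_p M → E`. -/
def chartDeriv (ψ : OpenPartialHomeomorph M E) (p : M) : TangentSpace 𝓘(ℝ, E) p →L[ℝ] E :=
  (mfderiv 𝓘(ℝ, E) 𝓘(ℝ, E) ψ p : TangentSpace 𝓘(ℝ, E) p →L[ℝ] TangentSpace 𝓘(ℝ, E) (ψ p))

/-- The derivative at `ψ p` of the inverse of a chart `ψ` at `p`, as a map `E → T_p M`. -/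
def chartDerivSymm (ψ : OpenPartialHomeomorph M E) (p : M) : E →L[ℝ] TangentSpace 𝓘(ℝ, E) p :=
  (mfderiv 𝓘(ℝ, E) 𝓘(ℝ, E) ψ.symm (ψ p) :
    TangentSpace 𝓘(ℝ, E) (ψ p) →L[ℝ] TangentSpace 𝓘(ℝ, E) (ψ.symm (ψ p)))

theorem chart_mdifferentiable {ψ : OpenPartialHomeomorph M E}
    (hψ : ψ ∈ IsManifold.maximalAtlas 𝓘(ℝ, E) ∞ M) :
    ψ.MDifferentiable 𝓘(ℝ, E) 𝓘(ℝ, E) :=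
  ⟨(contMDiffOn_of_mem_maximalAtlas hψ).mdifferentiableOn (by simp),
    (contMDiffOn_symm_of_mem_maximalAtlas hψ).mdifferentiableOn (by simp)⟩

theorem chartDerivSymm_chartDeriv {ψ : OpenPartialHomeomorph M E}
    (hψ : ψ ∈ IsManifold.maximalAtlas 𝓘(ℝ, E) ∞ M) {p : M} (hp : p ∈ ψ.source)
    (v : TangentSpace 𝓘(ℝ, E) p) : chartDerivSymm ψ p (chartDeriv ψ p v) = v :=
  congrArg (fun L : TangentSpace 𝓘(ℝ, E) p →L[ℝ] TangentSpace 𝓘(ℝ, E) p => L v)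
    ((chart_mdifferentiable hψ).symm_comp_deriv hp)

theorem chartDeriv_chartDerivSymm {ψ : OpenPartialHomeomorph M E}
    (hψ : ψ ∈ IsManifold.maximalAtlas 𝓘(ℝ, E) ∞ M) {p : M} (hp : p ∈ ψ.source)
    (v : E) : chartDeriv ψ p (chartDerivSymm ψ p v) = v := by
  have h := (chart_mdifferentiable hψ).comp_symm_deriv (ψ.map_source hp)
  rw [ψ.left_inv hp] at h
  exact congrArg (fun L : E →L[ℝ] E => L v) h

/-- Change of charts on tangent vectors is the derivative of the transition map. -/
theorem chartDeriv_chartDerivSymm_eq_fderiv {ψ ψ' : OpenPartialHomeomorph M E}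
    (hψ : ψ ∈ IsManifold.maximalAtlas 𝓘(ℝ, E) ∞ M)
    (hψ' : ψ' ∈ IsManifold.maximalAtlas 𝓘(ℝ, E) ∞ M) {p : M} (hp : p ∈ ψ.source)
    (hp' : p ∈ ψ'.source) (v : E) :
    chartDeriv ψ' p (chartDerivSymm ψ p v) = fderiv ℝ (ψ' ∘ ψ.symm) (ψ p) v := by
  have h1 := (chart_mdifferentiable hψ).mdifferentiableAt_symm (ψ.map_source hp)
  have h2 : MDifferentiableAt 𝓘(ℝ, E) 𝓘(ℝ, E) ψ' (ψ.symm (ψ p)) := by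
    rw [ψ.left_inv hp]; exact (chart_mdifferentiable hψ').mdifferentiableAt hp'
  have h := mfderiv_comp (ψ p) h2 h1
  rw [mfderiv_eq_fderiv, ψ.left_inv hp] at h
  rw [h]; rfl

theorem contDiffOn_chart_transition {ψ ψ' : OpenPartialHomeomorph M E}
    (hψ : ψ ∈ IsManifold.maximalAtlas 𝓘(ℝ, E) ∞ M)
    (hψ' : ψ' ∈ IsManifold.maximalAtlas 𝓘(ℝ, E) ∞ M) :
    ContDiffOn ℝ ∞ (ψ' ∘ ψ.symm) (ψ.symm.trans ψ').source := by
  rw [← contMDiffOn_iff_contDiffOn]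
  refine (contMDiffOn_of_mem_maximalAtlas hψ').comp
    ((contMDiffOn_symm_of_mem_maximalAtlas hψ).mono ?_) ?_
  · intro x hx; simp at hx; exact hx.1
  · intro x hx; simp at hx; exact hx.2

end ChartDerivatives

namespace BanachPair

variable {E₀ F E M₀ M : Type*}
  [NormedAddCommGroup E₀] [NormedSpace ℝ E₀] [NormedAddCommGroup F] [NormedSpace ℝ F]
  [NormedAddCommGroup E] [NormedSpace ℝ E]
  [TopologicalSpace M₀] [ChartedSpace E₀ M₀] [TopologicalSpace M] [ChartedSpace E M]

/-- The tangent space of `M₀` at `x` as a subspace of `T_x M`. -/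
def tangentRange (P : BanachPair E₀ F E M₀ M) (x : M₀) :
    Submodule ℝ (TangentSpace 𝓘(ℝ, E) (P.incl x)) :=
  (mfderiv 𝓘(ℝ, E₀) 𝓘(ℝ, E) P.incl x).range

/-- The fibre `T_x M / T_x M₀` of the normal bundle at `x ∈ M₀`. -/
abbrev NormalSpace (P : BanachPair E₀ F E M₀ M) (x : M₀) : Type _ :=
  TangentSpace 𝓘(ℝ, E) (P.incl x) ⧸ P.tangentRange x

/-- The (total space of the) normal bundle `ν(M, M₀) = TM|_{M₀} / TM₀`. -/
abbrev NormalBundle (P : BanachPair E₀ F E M₀ M) : Type _ :=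
  TotalSpace F P.NormalSpace

/-! #### The vector bundle structure of the normal bundle

Near `x₀ ∈ M₀`, take a chart `ψ` of `M` in which `M₀` is the subspace `E₀` of `E ≃ E₀ × F`. The
class of a tangent vector `X` then has the coordinate `pr_F (Dψ(X))`. -/

section Prebundle

variable (P : BanachPair E₀ F E M₀ M)

def chartM (x₀ : M₀) : OpenPartialHomeomorph M E := (P.isImmersion x₀).codChart
def chartM₀ (x₀ : M₀) : OpenPartialHomeomorph M₀ E₀ := (P.isImmersion x₀).domChart
def split (x₀ : M₀) : (E₀ × F) ≃L[ℝ] E := (P.isImmersion x₀).equiv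

theorem chartM_mem (x₀ : M₀) : P.chartM x₀ ∈ IsManifold.maximalAtlas 𝓘(ℝ, E) ∞ M :=
  (P.isImmersion x₀).codChart_mem_maximalAtlas

theorem chartM₀_mem (x₀ : M₀) : P.chartM₀ x₀ ∈ IsManifold.maximalAtlas 𝓘(ℝ, E₀) ∞ M₀ :=
  (P.isImmersion x₀).domChart_mem_maximalAtlas

theorem mem_chartM₀_source (x₀ : M₀) : x₀ ∈ (P.chartM₀ x₀).source :=
  (P.isImmersion x₀).mem_domChart_source

theorem incl_mem_source {x₀ y : M₀} (hy : y ∈ (P.chartM₀ x₀).source) :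
    P.incl y ∈ (P.chartM x₀).source :=
  (P.isImmersion x₀).source_subset_preimage_source hy

theorem chartM_incl {x₀ y : M₀} (hy : y ∈ (P.chartM₀ x₀).source) :
    P.chartM x₀ (P.incl y) = P.split x₀ (P.chartM₀ x₀ y, 0) := by
  have hm : P.chartM₀ x₀ y ∈ ((P.isImmersion x₀).domChart.extend 𝓘(ℝ, E₀)).target := by
    have := (P.chartM₀ x₀).map_source hy
    simpa [chartM₀] using this
  have h := (P.isImmersion x₀).writtenInCharts hm
  have h' : (P.isImmersion x₀).domChart.symm ((P.chartM₀ x₀) y) = y :=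
    (P.chartM₀ x₀).left_inv hy
  simp [h'] at h
  exact h

theorem contMDiff_incl [IsManifold 𝓘(ℝ, E₀) ∞ M₀] [IsManifold 𝓘(ℝ, E) ∞ M] :
    ContMDiff 𝓘(ℝ, E₀) 𝓘(ℝ, E) ∞ P.incl := fun x => (P.isImmersion x).contMDiffAt

/-- The `F`-component of the derivative of the chart around `x₀`. -/
def preCoord (x₀ y : M₀) : TangentSpace 𝓘(ℝ, E) (P.incl y) →L[ℝ] F :=
  (ContinuousLinearMap.snd ℝ E₀ F).comp
    (((P.split x₀).symm : E →L[ℝ] E₀ × F).comp (chartDeriv (P.chartM x₀) (P.incl y)))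

/-- The tangent vector with the given `F`-component and zero `E₀`-component. -/
def preCoordSymm (x₀ y : M₀) : F →L[ℝ] TangentSpace 𝓘(ℝ, E) (P.incl y) :=
  (chartDerivSymm (P.chartM x₀) (P.incl y)).comp
    ((P.split x₀ : E₀ × F →L[ℝ] E).comp (ContinuousLinearMap.inr ℝ E₀ F))

/-- The inverse of the fibre coordinate. -/
def coordSymm (x₀ y : M₀) : F →L[ℝ] P.NormalSpace y :=
  (P.tangentRange y).mkQL.comp (P.preCoordSymm x₀ y)

/-- The change of fibre coordinates: the `F`-block of the derivative of the transition map. -/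
def coordChange (x₀ x₁ y : M₀) : F →L[ℝ] F :=
  (ContinuousLinearMap.snd ℝ E₀ F).comp (((P.split x₁).symm : E →L[ℝ] E₀ × F).comp
    ((fderiv ℝ (P.chartM x₁ ∘ (P.chartM x₀).symm) (P.chartM x₀ (P.incl y))).comp
      ((P.split x₀ : E₀ × F →L[ℝ] E).comp (ContinuousLinearMap.inr ℝ E₀ F))))

variable [IsManifold 𝓘(ℝ, E₀) ∞ M₀] [IsManifold 𝓘(ℝ, E) ∞ M]

theorem chartDeriv_mfderiv_incl {x₀ y : M₀} (hy : y ∈ (P.chartM₀ x₀).source)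
    (v : TangentSpace 𝓘(ℝ, E₀) y) :
    chartDeriv (P.chartM x₀) (P.incl y) (mfderiv 𝓘(ℝ, E₀) 𝓘(ℝ, E) P.incl y v) =
      P.split x₀ (chartDeriv (P.chartM₀ x₀) y v, 0) := by
  have hι : MDifferentiableAt 𝓘(ℝ, E₀) 𝓘(ℝ, E) P.incl y :=
    (P.contMDiff_incl y).mdifferentiableAt (by simp)
  have hψ := (chart_mdifferentiable (P.chartM_mem x₀)).mdifferentiableAt (P.incl_mem_source hy)
  have hφ := (chart_mdifferentiable (P.chartM₀_mem x₀)).mdifferentiableAt hy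
  have h1 := mfderiv_comp y hψ hι
  let L : E₀ →L[ℝ] E := (P.split x₀ : E₀ × F →L[ℝ] E).comp (ContinuousLinearMap.inl ℝ E₀ F)
  have hL : MDifferentiableAt 𝓘(ℝ, E₀) 𝓘(ℝ, E) L (P.chartM₀ x₀ y) :=
    L.differentiableAt.mdifferentiableAt
  have h2 := mfderiv_comp y hL hφ
  have heq : P.chartM x₀ ∘ P.incl =ᶠ[𝓝 y] L ∘ P.chartM₀ x₀ := by
    filter_upwards [(P.chartM₀ x₀).open_source.mem_nhds hy] with z hz
    simpa [L] using P.chartM_incl hz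
  have h3 : mfderiv 𝓘(ℝ, E₀) 𝓘(ℝ, E) (P.chartM x₀ ∘ P.incl) y =
      mfderiv 𝓘(ℝ, E₀) 𝓘(ℝ, E) (L ∘ P.chartM₀ x₀) y := heq.mfderiv_eq
  have h4 : mfderiv 𝓘(ℝ, E₀) 𝓘(ℝ, E) L (P.chartM₀ x₀ y) = L := by
    rw [mfderiv_eq_fderiv]; exact L.fderiv
  rw [h4] at h2
  have h5 := (h1.symm.trans (h3.trans h2))
  exact congrArg (fun A : TangentSpace 𝓘(ℝ, E₀) y →L[ℝ] E => A v) h5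

theorem ker_preCoord {x₀ y : M₀} (hy : y ∈ (P.chartM₀ x₀).source) :
    (P.preCoord x₀ y).ker = P.tangentRange y := by
  ext X
  constructor
  · intro hX
    have hX' : ((P.split x₀).symm (chartDeriv (P.chartM x₀) (P.incl y) X)).2 = 0 := hX
    set u := ((P.split x₀).symm (chartDeriv (P.chartM x₀) (P.incl y) X)).1 with hu
    refine ⟨chartDerivSymm (P.chartM₀ x₀) y u, ?_⟩
    have h := P.chartDeriv_mfderiv_incl hy (chartDerivSymm (P.chartM₀ x₀) y u)
    rw [chartDeriv_chartDerivSymm (P.chartM₀_mem x₀) hy] at h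
    have h2 : P.split x₀ (u, 0) = chartDeriv (P.chartM x₀) (P.incl y) X := by
      rw [← hX', hu]; simp
    rw [h2] at h
    have h3 := congrArg (chartDerivSymm (P.chartM x₀) (P.incl y)) h
    rwa [chartDerivSymm_chartDeriv (P.chartM_mem x₀) (P.incl_mem_source hy),
      chartDerivSymm_chartDeriv (P.chartM_mem x₀) (P.incl_mem_source hy)] at h3
  · rintro ⟨v, rfl⟩
    have h := P.chartDeriv_mfderiv_incl hy v
    change ((P.split x₀).symm (chartDeriv (P.chartM x₀) (P.incl y)
      (mfderiv 𝓘(ℝ, E₀) 𝓘(ℝ, E) P.incl y v))).2 = 0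
    rw [h]; simp

theorem preCoord_preCoordSymm {x₀ y : M₀} (hy : y ∈ (P.chartM₀ x₀).source) (w : F) :
    P.preCoord x₀ y (P.preCoordSymm x₀ y w) = w := by
  change ((P.split x₀).symm (chartDeriv (P.chartM x₀) (P.incl y)
    (chartDerivSymm (P.chartM x₀) (P.incl y) (P.split x₀ (0, w))))).2 = w
  rw [chartDeriv_chartDerivSymm (P.chartM_mem x₀) (P.incl_mem_source hy)]
  simp

open Classical in
/-- The fibre coordinate of the normal bundle in the chart around `x₀` (zero off the chart). -/
def coord (x₀ y : M₀) : P.NormalSpace y →L[ℝ] F :=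
  if hy : y ∈ (P.chartM₀ x₀).source then
    (P.tangentRange y).liftQL (P.preCoord x₀ y) (P.ker_preCoord hy).ge
  else 0

theorem coord_mk {x₀ y : M₀} (hy : y ∈ (P.chartM₀ x₀).source)
    (X : TangentSpace 𝓘(ℝ, E) (P.incl y)) :
    P.coord x₀ y (Submodule.Quotient.mk X) = P.preCoord x₀ y X := by
  rw [coord, dif_pos hy]; rfl

theorem coord_coordSymm {x₀ y : M₀} (hy : y ∈ (P.chartM₀ x₀).source) (w : F) :
    P.coord x₀ y (P.coordSymm x₀ y w) = w :=
  (P.coord_mk hy _).trans (P.preCoord_preCoordSymm hy w)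

theorem coordSymm_coord {x₀ y : M₀} (hy : y ∈ (P.chartM₀ x₀).source) (X : P.NormalSpace y) :
    P.coordSymm x₀ y (P.coord x₀ y X) = X := by
  induction X using Submodule.Quotient.induction_on with
  | _ X =>
    rw [P.coord_mk hy]
    refine (Submodule.Quotient.eq _).2 ?_
    rw [← P.ker_preCoord hy]
    change P.preCoord x₀ y (P.preCoordSymm x₀ y (P.preCoord x₀ y X) - X) = 0
    rw [map_sub, P.preCoord_preCoordSymm hy, sub_self]

/-- The local trivialization of the normal bundle over the chart around `x₀`. -/
def pretriv (x₀ : M₀) : Pretrivialization F (π F P.NormalSpace) where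
  toFun z := (z.1, P.coord x₀ z.1 z.2)
  invFun w := ⟨w.1, P.coordSymm x₀ w.1 w.2⟩
  source := π F P.NormalSpace ⁻¹' (P.chartM₀ x₀).source
  target := (P.chartM₀ x₀).source ×ˢ univ
  map_source' z hz := ⟨hz, trivial⟩
  map_target' w hw := hw.1
  left_inv' := by
    rintro ⟨y, X⟩ hz
    exact congrArg (TotalSpace.mk y) (P.coordSymm_coord hz X)
  right_inv' := by
    rintro ⟨y, w⟩ hw
    exact Prod.ext rfl (P.coord_coordSymm hw.1 w)
  open_target := (P.chartM₀ x₀).open_source.prod isOpen_univ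
  baseSet := (P.chartM₀ x₀).source
  open_baseSet := (P.chartM₀ x₀).open_source
  source_eq := rfl
  target_eq := rfl
  proj_toFun _ _ := rfl

theorem pretriv_symm {x₀ y : M₀} (hy : y ∈ (P.chartM₀ x₀).source) (w : F) :
    (P.pretriv x₀).symm y w = P.coordSymm x₀ y w := by
  have h := (P.pretriv x₀).mk_symm (b := y) hy w
  have h' : (P.pretriv x₀).toPartialEquiv.symm (y, w) = ⟨y, P.coordSymm x₀ y w⟩ := rfl
  rw [h'] at h
  exact eq_of_heq (TotalSpace.mk.inj h).2

theorem coordChange_eq {x₀ x₁ y : M₀} (hy : y ∈ (P.chartM₀ x₀).source)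
    (hy' : y ∈ (P.chartM₀ x₁).source) (w : F) :
    P.coordChange x₀ x₁ y w = (P.pretriv x₁ ⟨y, (P.pretriv x₀).symm y w⟩).2 := by
  rw [P.pretriv_symm hy]
  refine Eq.trans ?_ (P.coord_mk hy' (P.preCoordSymm x₀ y w)).symm
  have h := chartDeriv_chartDerivSymm_eq_fderiv (P.chartM_mem x₀) (P.chartM_mem x₁)
    (P.incl_mem_source hy) (P.incl_mem_source hy') (P.split x₀ (0, w))
  exact congrArg (fun u => ((P.split x₁).symm u).2) h.symm

theorem contMDiffOn_coordChange (x₀ x₁ : M₀) :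
    ContMDiffOn 𝓘(ℝ, E₀) 𝓘(ℝ, F →L[ℝ] F) ∞ (P.coordChange x₀ x₁)
      ((P.chartM₀ x₀).source ∩ (P.chartM₀ x₁).source) := by
  have h1 : ContDiffOn ℝ ∞ (fderiv ℝ (P.chartM x₁ ∘ (P.chartM x₀).symm))
      ((P.chartM x₀).symm.trans (P.chartM x₁)).source :=
    (contDiffOn_chart_transition (P.chartM_mem x₀) (P.chartM_mem x₁)).fderiv_of_isOpen
      (OpenPartialHomeomorph.open_source _) (by simp)
  have h2 : ContMDiffOn 𝓘(ℝ, E₀) 𝓘(ℝ, E) ∞ (P.chartM x₀ ∘ P.incl)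
      ((P.chartM₀ x₀).source ∩ (P.chartM₀ x₁).source) :=
    (contMDiffOn_of_mem_maximalAtlas (P.chartM_mem x₀)).comp P.contMDiff_incl.contMDiffOn
      (fun y hy => P.incl_mem_source hy.1)
  have h3 := h1.contMDiffOn.comp h2 (fun y hy => by
    simp [P.incl_mem_source hy.1, P.incl_mem_source hy.2,
      (P.chartM x₀).map_source (P.incl_mem_source hy.1)])
  have c1 : ContMDiffOn 𝓘(ℝ, E₀) 𝓘(ℝ, F →L[ℝ] E) ∞ _ _ := h3.clm_comp
    (contMDiffOn_const (c := (P.split x₀ : E₀ × F →L[ℝ] E).comp (ContinuousLinearMap.inr ℝ E₀ F)))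
  exact (contMDiffOn_const
    (c := (ContinuousLinearMap.snd ℝ E₀ F).comp ((P.split x₁).symm : E →L[ℝ] E₀ × F))).clm_comp c1

/-- The normal bundle as a vector bundle given by its local trivializations. -/
def normalPrebundle : VectorPrebundle ℝ F P.NormalSpace where
  pretrivializationAtlas := range P.pretriv
  pretrivialization_linear' := by
    rintro _ ⟨x₀, rfl⟩
    exact ⟨fun y _ => ⟨fun u v => map_add (P.coord x₀ y) u v,
      fun c u => map_smul (P.coord x₀ y) c u⟩⟩
  pretrivializationAt := P.pretriv
  mem_base_pretrivializationAt := P.mem_chartM₀_source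
  pretrivialization_mem_atlas x := ⟨x, rfl⟩
  exists_coordChange := by
    rintro _ ⟨x₀, rfl⟩ _ ⟨x₁, rfl⟩
    exact ⟨P.coordChange x₀ x₁, (P.contMDiffOn_coordChange x₀ x₁).continuousOn,
      fun y hy w => P.coordChange_eq hy.1 hy.2 w⟩
  totalSpaceMk_isInducing x := by
    let e : P.NormalSpace x ≃L[ℝ] F := ContinuousLinearEquiv.equivOfInverse
      (P.coord x x) (P.coordSymm x x) (P.coordSymm_coord (P.mem_chartM₀_source x))
      (P.coord_coordSymm (P.mem_chartM₀_source x))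
    exact (isInducing_const_prod (x := x)).2 e.toHomeomorph.isInducing

instance : TopologicalSpace P.NormalBundle := P.normalPrebundle.totalSpaceTopology

instance : FiberBundle F P.NormalSpace := P.normalPrebundle.toFiberBundle

instance : VectorBundle ℝ F P.NormalSpace := P.normalPrebundle.toVectorBundle

instance : P.normalPrebundle.IsContMDiff 𝓘(ℝ, E₀) ∞ where
  exists_contMDiffCoordChange := by
    rintro _ ⟨x₀, rfl⟩ _ ⟨x₁, rfl⟩
    exact ⟨P.coordChange x₀ x₁, P.contMDiffOn_coordChange x₀ x₁,
      fun y hy w => P.coordChange_eq hy.1 hy.2 w⟩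

/-- The normal bundle is a smooth vector bundle over `M₀`; in particular `ν(M, M₀)` is a smooth
manifold modelled on `E₀ × F`. -/
instance : ContMDiffVectorBundle ∞ F P.NormalSpace 𝓘(ℝ, E₀) :=
  P.normalPrebundle.contMDiffVectorBundle 𝓘(ℝ, E₀)

end Prebundle

/-! #### The normal bundle of a sub-pair -/

section SubPair

variable (P : BanachPair E₀ F E M₀ M)

/-- The fibre `T_x S / T_x S₀` at `x ∈ S₀`, for submanifolds `S ⊆ M` and `S₀ ⊆ M₀`. -/
abbrev SubNormalSpace (S : Set M) (S₀ : Set M₀) (x : M₀) : Type _ :=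
  tangentSub 𝓘(ℝ, E) S (P.incl x) ⧸
    (((tangentSub 𝓘(ℝ, E₀) S₀ x).map
      (mfderiv 𝓘(ℝ, E₀) 𝓘(ℝ, E) P.incl x).toLinearMap).submoduleOf
        (tangentSub 𝓘(ℝ, E) S (P.incl x)))

/-- The linear map `T_x S / T_x S₀ → T_x M / T_x M₀` induced by the inclusion `T_x S ⊆ T_x M`. -/
def subNormalMap (S : Set M) (S₀ : Set M₀) (x : M₀) :
    P.SubNormalSpace S S₀ x →ₗ[ℝ] P.NormalSpace x :=
  Submodule.mapQ _ _ (tangentSub 𝓘(ℝ, E) S (P.incl x)).subtype (by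
    rintro v ⟨w, -, hw⟩
    exact ⟨w, hw⟩)

/-- The normal bundle `ν(S, S₀) = TS|_{S₀} / TS₀` of a sub-pair. -/
def SubNormalBundle (S : Set M) (S₀ : Set M₀) : Type _ :=
  Σ x : S₀, P.SubNormalSpace S S₀ x

/-- The canonical map `ν(S, S₀) → ν(M, M₀)`. -/
def subNormalIncl (S : Set M) (S₀ : Set M₀) (p : P.SubNormalBundle S S₀) : P.NormalBundle :=
  ⟨p.1, P.subNormalMap S S₀ p.1 p.2⟩

end SubPair

end BanachPair

/-! ### Maps of pairs -/

/-- A map of pairs `(f, f₀) : (M, M₀) → (N, N₀)`: smooth maps `f : M → N` and `f₀ : M₀ → N₀`, such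
that `f` restricts to `f₀`. -/
structure BanachPair.Hom {E₀ F E M₀ M E₀' F' E' N₀ N : Type*}
    [NormedAddCommGroup E₀] [NormedSpace ℝ E₀] [NormedAddCommGroup F] [NormedSpace ℝ F]
    [NormedAddCommGroup E] [NormedSpace ℝ E]
    [TopologicalSpace M₀] [ChartedSpace E₀ M₀] [TopologicalSpace M] [ChartedSpace E M]
    [NormedAddCommGroup E₀'] [NormedSpace ℝ E₀'] [NormedAddCommGroup F'] [NormedSpace ℝ F']
    [NormedAddCommGroup E'] [NormedSpace ℝ E']
    [TopologicalSpace N₀] [ChartedSpace E₀' N₀] [TopologicalSpace N] [ChartedSpace E' N]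
    (P : BanachPair E₀ F E M₀ M) (Q : BanachPair E₀' F' E' N₀ N) where
  map : M → N
  map₀ : M₀ → N₀
  contMDiff_map : ContMDiff 𝓘(ℝ, E) 𝓘(ℝ, E') ∞ map
  contMDiff_map₀ : ContMDiff 𝓘(ℝ, E₀) 𝓘(ℝ, E₀') ∞ map₀
  comm : ∀ x, map (P.incl x) = Q.incl (map₀ x)

namespace BanachPair.Hom

variable {E₀ F E M₀ M E₀' F' E' N₀ N : Type*}
  [NormedAddCommGroup E₀] [NormedSpace ℝ E₀] [NormedAddCommGroup F] [NormedSpace ℝ F]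
  [NormedAddCommGroup E] [NormedSpace ℝ E]
  [TopologicalSpace M₀] [ChartedSpace E₀ M₀] [TopologicalSpace M] [ChartedSpace E M]
  [NormedAddCommGroup E₀'] [NormedSpace ℝ E₀'] [NormedAddCommGroup F'] [NormedSpace ℝ F']
  [NormedAddCommGroup E'] [NormedSpace ℝ E']
  [TopologicalSpace N₀] [ChartedSpace E₀' N₀] [TopologicalSpace N] [ChartedSpace E' N]
  {P : BanachPair E₀ F E M₀ M} {Q : BanachPair E₀' F' E' N₀ N} (f : P.Hom Q)

/-- The derivative `Df_x : T_x M → T_{f₀ x} N` at a point `x ∈ M₀`. -/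
def derivAt (x : M₀) :
    TangentSpace 𝓘(ℝ, E) (P.incl x) →L[ℝ] TangentSpace 𝓘(ℝ, E') (Q.incl (f.map₀ x)) :=
  f.comm x ▸ mfderiv 𝓘(ℝ, E) 𝓘(ℝ, E') f.map (P.incl x)

theorem derivAt_mfderiv_incl [IsManifold 𝓘(ℝ, E₀) ∞ M₀] [IsManifold 𝓘(ℝ, E) ∞ M]
    [IsManifold 𝓘(ℝ, E₀') ∞ N₀] [IsManifold 𝓘(ℝ, E') ∞ N]
    (x : M₀) (v : TangentSpace 𝓘(ℝ, E₀) x) :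
    f.derivAt x (mfderiv 𝓘(ℝ, E₀) 𝓘(ℝ, E) P.incl x v) =
      mfderiv 𝓘(ℝ, E₀') 𝓘(ℝ, E') Q.incl (f.map₀ x)
        (mfderiv 𝓘(ℝ, E₀) 𝓘(ℝ, E₀') f.map₀ x v) := by
  have h1 := mfderiv_comp x ((f.contMDiff_map (P.incl x)).mdifferentiableAt (by simp))
    ((P.contMDiff_incl x).mdifferentiableAt (by simp))
  have h2 := mfderiv_comp x ((Q.contMDiff_incl (f.map₀ x)).mdifferentiableAt (by simp))
    ((f.contMDiff_map₀ x).mdifferentiableAt (by simp))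
  have h3 : f.map ∘ P.incl = Q.incl ∘ f.map₀ := funext f.comm
  have key : ∀ (q : N) (h : f.map (P.incl x) = q)
      (L : TangentSpace 𝓘(ℝ, E) (P.incl x) →L[ℝ] TangentSpace 𝓘(ℝ, E') (f.map (P.incl x)))
      (u : TangentSpace 𝓘(ℝ, E) (P.incl x)),
      ((h ▸ L : TangentSpace 𝓘(ℝ, E) (P.incl x) →L[ℝ] TangentSpace 𝓘(ℝ, E') q) u : E') =
        (L u : E') := by
    intro q h L u; subst h; rfl
  refine (key _ (f.comm x) _ _).trans ?_
  rw [h3] at h1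
  exact congrArg (fun L : E₀ →L[ℝ] E' => L v) (h1.symm.trans h2)

variable [IsManifold 𝓘(ℝ, E₀) ∞ M₀] [IsManifold 𝓘(ℝ, E) ∞ M]
  [IsManifold 𝓘(ℝ, E₀') ∞ N₀] [IsManifold 𝓘(ℝ, E') ∞ N]

/-- The induced map on the fibres of the normal bundles, `[X] ↦ [Df(X)]`. -/
def normalSpaceMap (x : M₀) : P.NormalSpace x →ₗ[ℝ] Q.NormalSpace (f.map₀ x) :=
  Submodule.mapQ _ _ (f.derivAt x).toLinearMap (by
    rintro _ ⟨v, rfl⟩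
    exact ⟨mfderiv 𝓘(ℝ, E₀) 𝓘(ℝ, E₀') f.map₀ x v, (f.derivAt_mfderiv_incl x v).symm⟩)

/-- The induced map `f_* : ν(M, M₀) → ν(N, N₀)`. -/
def normalMap (p : P.NormalBundle) : Q.NormalBundle :=
  ⟨f.map₀ p.1, f.normalSpaceMap p.1 p.2⟩

end BanachPair.Hom

end

/-! Everything is reduced to local defining functions. Near each of its points a submanifold `S` is
the zero set of a map `g` to a Banach space `W` that is a split linear surjection in some chart, and
conversely such a zero set is a submanifold (`IsSubmanifold.exists_isDefiningAt`,
`IsDefiningAt.exists_chart`). Then `TS = ker Dg` along `S`, and `f` is transverse to `S` at `x`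
exactly when `D(g ∘ f)` has a continuous right inverse at `x` (`IsDefiningAt.transverse_iff`). By
the inverse function theorem `g ∘ f` is then a defining function of `f⁻¹(S)`, with tangent space
`Df⁻¹(TS)`.

Corollary: `TS` has the defining function `(g, Dg)`, and the chain rule turns its composition with
`Df` into `(g ∘ f, D(g ∘ f))`, again a submersion.

Normal bundles: since `Z` is transverse to `N₀`, one has `TN₀ + TZ = TN` and `TZ₀ = TZ ∩ TN₀` along
`Z₀`, so `TZ / TZ₀ → TN / TN₀` is bijective and `ν(Z, Z₀)` is the whole restriction `π⁻¹(Z₀)`. The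
two transversality assumptions on `f` and `f₀` give the same for `f⁻¹(Z)` and `M₀`, so that
`ν(f⁻¹(Z), f₀⁻¹(Z₀)) = π⁻¹(f₀⁻¹(Z₀))`. As `f_*` covers `f₀`, the preimage formula is immediate, and
transversality of `f_*` follows from that of `f₀` because bundle projections are split submersions
(`IsTransverse.proj_preimage`). Smoothness of `f_*` holds because its fibre part is a block of the
derivative of `f` in charts. -/

noncomputable section

/-! ### Linear algebra of split surjections -/

section SplitSurjections

variable {E W W' : Type*} [NormedAddCommGroup E] [NormedSpace ℝ E]
  [NormedAddCommGroup W] [NormedSpace ℝ W] [NormedAddCommGroup W'] [NormedSpace ℝ W']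

theorem ContinuousLinearMap.HasRightInverse.closedComplemented_ker {q : E →L[ℝ] W}
    (hq : q.HasRightInverse) : q.ker.ClosedComplemented := by
  obtain ⟨R, hR⟩ := hq
  exact q.closedComplemented_ker_of_rightInverse R hR

/-- A surjection of Banach spaces with complemented kernel has a continuous right inverse. -/
theorem ContinuousLinearMap.hasRightInverse_of_closedComplemented_ker
    [CompleteSpace E] [CompleteSpace W] {q : E →L[ℝ] W} (hs : Surjective q)
    (hk : q.ker.ClosedComplemented) : q.HasRightInverse := by
  obtain ⟨p, hp⟩ := hk
  -- The pair `(q, p)` is a continuous bijection onto `W × ker q`, hence an isomorphism by the open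
  -- mapping theorem; the right inverse is its inverse on `W × 0`.
  let T : E →L[ℝ] W × q.ker := q.prod p
  have hT0 : T.ker = ⊥ := by
    refine (Submodule.eq_bot_iff _).2 fun x hx => ?_
    have h1 : q x = 0 := congrArg Prod.fst (show T x = 0 from hx)
    have h2 : p x = 0 := congrArg Prod.snd (show T x = 0 from hx)
    have h3 := hp ⟨x, h1⟩
    rw [h2] at h3
    exact (congrArg Subtype.val h3).symm
  have hT1 : T.range = ⊤ := by
    refine LinearMap.range_eq_top.2 fun ⟨w, k⟩ => ?_
    obtain ⟨e, he⟩ := hs w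
    refine ⟨e - p e + k, Prod.ext ?_ ?_⟩
    · have h1 : q (p e : E) = 0 := (p e).2
      have h2 : q (k : E) = 0 := k.2
      change q (e - p e + k) = w
      simp [h1, h2, he]
    · change p (e - p e + k) = k
      simp [hp]
  have : IsClosed (q.ker : Set E) := q.isClosed_ker
  have : CompleteSpace q.ker := this.completeSpace_coe
  let Te := ContinuousLinearEquiv.ofBijective T hT0 hT1
  refine ⟨(Te.symm : W × q.ker →L[ℝ] E).comp (ContinuousLinearMap.inl ℝ W q.ker), fun w => ?_⟩
  have : T (Te.symm (w, 0)) = (w, 0) := Te.apply_symm_apply _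
  exact congrArg Prod.fst this

end SplitSurjections

/-! ### Submersions in linear form -/

section InverseFunction

variable {E : Type*} [NormedAddCommGroup E] [NormedSpace ℝ E] [CompleteSpace E]

/-- The inverse function theorem for `C^∞` maps tangent to the identity. -/
theorem exists_openPartialHomeomorph_of_hasFDerivAt_id {Φ : E → E} {O : Set E} (hO : IsOpen O)
    (hΦ : ContDiffOn ℝ ∞ Φ O) {e₀ : E} (he₀ : e₀ ∈ O)
    (hd : HasFDerivAt Φ (ContinuousLinearMap.id ℝ E) e₀) :
    ∃ ρ : OpenPartialHomeomorph E E, e₀ ∈ ρ.source ∧ ρ.source ⊆ O ∧ (∀ e, ρ e = Φ e) ∧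
      ContDiffOn ℝ ∞ ρ ρ.source ∧ ContDiffOn ℝ ∞ ρ.symm ρ.target := by
  have hat : ∀ e ∈ O, ContDiffAt ℝ ∞ Φ e := fun e he => hΦ.contDiffAt (hO.mem_nhds he)
  have hd' : HasFDerivAt Φ ((ContinuousLinearEquiv.refl ℝ E : E ≃L[ℝ] E) : E →L[ℝ] E) e₀ := hd
  let ρ₀ := (hat e₀ he₀).toOpenPartialHomeomorph Φ hd' (by simp)
  -- Invertible operators form an open set, so the derivative stays invertible on a neighbourhood
  -- `O'` of `e₀`; this makes the inverse smooth on the whole target, not only at the image of `e₀`.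
  let O' : Set E := O ∩ fderiv ℝ Φ ⁻¹' range ((↑) : (E ≃L[ℝ] E) → E →L[ℝ] E)
  have hO' : IsOpen O' :=
    (hΦ.continuousOn_fderiv_of_isOpen hO (by simp)).isOpen_inter_preimage hO
      ContinuousLinearEquiv.isOpen
  have he₀' : e₀ ∈ O' := ⟨he₀, ContinuousLinearEquiv.refl ℝ E, hd'.fderiv.symm⟩
  refine ⟨ρ₀.restrOpen O' hO', ⟨?_, he₀'⟩, fun e he => he.2.1, fun e => rfl,
    fun e he => (hat e he.2.1).contDiffWithinAt, fun e he => ?_⟩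
  · exact (hat e₀ he₀).mem_toOpenPartialHomeomorph_source hd' (by simp)
  · have hs := (ρ₀.restrOpen O' hO').map_target he
    obtain ⟨L, hL⟩ := hs.2.2
    refine ((ρ₀.restrOpen O' hO').contDiffAt_symm (f₀' := L) he ?_ (hat _ hs.2.1)).contDiffWithinAt
    rw [hL]
    exact ((hat _ hs.2.1).differentiableAt (by simp)).hasFDerivAt

end InverseFunction

section LinearSubmersion

variable {E : Type*} [NormedAddCommGroup E] [NormedSpace ℝ E]
  {H : Type*} [TopologicalSpace H] (I : ModelWithCorners ℝ E H)
  {M : Type*} [TopologicalSpace M] [ChartedSpace H M]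
  {W : Type*} [NormedAddCommGroup W] [NormedSpace ℝ W]

/-- In some chart around `x`, the map `g` is a split linear surjection. -/
def IsLinearSubmersionAt (g : M → W) (x : M) : Prop :=
  ∃ ψ ∈ IsManifold.maximalAtlas I ∞ M, x ∈ ψ.source ∧
    ∃ q : E →L[ℝ] W, q.HasRightInverse ∧ ∀ y ∈ ψ.source, g y = q (ψ.extend I y)

/-- The zero set of `g`, a split linear surjection in a chart, is `S` near `x`. -/
def IsDefiningAt (S : Set M) (g : M → W) (x : M) : Prop :=
  IsLinearSubmersionAt I g x ∧ ∀ᶠ y in 𝓝 x, (y ∈ S ↔ g y = 0)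

variable {I}

theorem IsLinearSubmersionAt.eventually {g : M → W} {x : M} (h : IsLinearSubmersionAt I g x) :
    ∀ᶠ y in 𝓝 x, IsLinearSubmersionAt I g y := by
  obtain ⟨ψ, hψ, hx, q, hq, hg⟩ := h
  filter_upwards [ψ.open_source.mem_nhds hx] with y hy
  exact ⟨ψ, hψ, hy, q, hq, hg⟩

theorem IsDefiningAt.eventually {S : Set M} {g : M → W} {x : M} (h : IsDefiningAt I S g x) :
    ∀ᶠ y in 𝓝 x, IsDefiningAt I S g y :=
  h.1.eventually.and h.2.eventually_nhds

theorem IsLinearSubmersionAt.exists_contMDiffOn {g : M → W} {x : M}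
    (h : IsLinearSubmersionAt I g x) :
    ∃ U : Set M, IsOpen U ∧ x ∈ U ∧ ContMDiffOn I 𝓘(ℝ, W) ∞ g U := by
  obtain ⟨ψ, hψ, hx, q, hq, hg⟩ := h
  exact ⟨ψ.source, ψ.open_source, hx,
    (q.contMDiff.comp_contMDiffOn (ψ.contMDiffOn_extend hψ)).congr hg⟩

theorem IsLinearSubmersionAt.contMDiffAt {g : M → W} {x : M}
    (h : IsLinearSubmersionAt I g x) : ContMDiffAt I 𝓘(ℝ, W) ∞ g x := by
  obtain ⟨U, hU, hx, hg⟩ := h.exists_contMDiffOn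
  exact hg.contMDiffAt (hU.mem_nhds hx)

theorem IsLinearSubmersionAt.mdifferentiableAt {g : M → W} {x : M}
    (h : IsLinearSubmersionAt I g x) : MDifferentiableAt I 𝓘(ℝ, W) g x :=
  h.contMDiffAt.mdifferentiableAt (by simp)

/-- A map with a differentiable local section, up to a translation, has split derivative. -/
theorem hasRightInverse_mfderiv_of_section {g : M → W} {s : W → M} {w₀ c : W}
    (hg : MDifferentiableAt I 𝓘(ℝ, W) g (s w₀)) (hs : MDifferentiableAt 𝓘(ℝ, W) I s w₀)
    (h : ∀ᶠ w in 𝓝 w₀, g (s w) = c + w) : (mfderiv I 𝓘(ℝ, W) g (s w₀)).HasRightInverse := by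
  refine ⟨mfderiv 𝓘(ℝ, W) I s w₀, fun w => ?_⟩
  have h1 := mfderiv_comp w₀ hg hs
  have h2 : g ∘ s =ᶠ[𝓝 w₀] fun w => c + w := h
  have h3 : HasFDerivAt (fun w => c + w) (ContinuousLinearMap.id ℝ W) w₀ :=
    (hasFDerivAt_id w₀).const_add c
  rw [h2.mfderiv_eq, mfderiv_eq_fderiv, h3.fderiv] at h1
  exact (congrArg (fun L : W →L[ℝ] W => L w) h1).symm

variable [I.Boundaryless]

/-- A right inverse `R` of `q` gives the local section `s w = ψ⁻¹(ψ x + R w)`, which satisfies `g (s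
w) = g x + w`; its derivative at `0` splits that of `g`. -/
theorem IsLinearSubmersionAt.hasRightInverse_mfderiv {g : M → W} {x : M}
    (h : IsLinearSubmersionAt I g x) : (mfderiv I 𝓘(ℝ, W) g x).HasRightInverse := by
  have hg' := h.mdifferentiableAt
  obtain ⟨ψ, hψ, hx, q, ⟨R, hR⟩, hg⟩ := h
  have hx' : ψ.extend I x ∈ (ψ.extend I).target :=
    (ψ.extend I).map_source (by rwa [ψ.extend_source])
  have hopen : IsOpen (ψ.extend I).target := ψ.isOpen_extend_target
  let s : W → M := fun w => (ψ.extend I).symm (ψ.extend I x + R w)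
  have hs0 : s 0 = x := by
    simp only [s, map_zero, add_zero]
    exact (ψ.extend I).left_inv (by rwa [ψ.extend_source])
  have hcont : ContMDiffAt 𝓘(ℝ, E) I ∞ (ψ.extend I).symm (ψ.extend I x + R 0) := by
    rw [map_zero, add_zero]
    refine (contMDiffOn_extend_symm hψ).contMDiffAt ?_
    rw [← ψ.extend_target']
    exact hopen.mem_nhds hx'
  have hR1 : ContMDiff 𝓘(ℝ, W) 𝓘(ℝ, E) ∞ (fun w => ψ.extend I x + R w) :=
    (contDiff_const.add R.contDiff).contMDiff
  have hs : MDifferentiableAt 𝓘(ℝ, W) I s 0 :=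
    (hcont.comp 0 hR1.contMDiffAt).mdifferentiableAt (by simp)
  have := hasRightInverse_mfderiv_of_section (I := I) (g := g) (s := s) (w₀ := 0)
    (c := q (ψ.extend I x)) (by rwa [hs0]) hs ?_
  · rwa [hs0] at this
  · have h0 : ∀ᶠ w in 𝓝 (0 : W), ψ.extend I x + R w ∈ (ψ.extend I).target := by
      refine hR1.continuous.continuousAt.eventually (hopen.mem_nhds ?_)
      simpa using hx'
    filter_upwards [h0] with w hw
    have h1 := (ψ.extend I).map_target hw
    rw [ψ.extend_source] at h1
    rw [hg _ h1, (ψ.extend I).right_inv hw, map_add, hR w]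

/-- A smooth map with split surjective derivative at `x` is linear in a chart around `x`. -/
theorem isLinearSubmersionAt_of_hasRightInverse [CompleteSpace E] [IsManifold I ∞ M]
    {g : M → W} {x : M} {U : Set M} (hU : IsOpen U) (hx : x ∈ U)
    (hg : ContMDiffOn I 𝓘(ℝ, W) ∞ g U) (hr : (mfderiv I 𝓘(ℝ, W) g x).HasRightInverse) :
    IsLinearSubmersionAt I g x := by
  set e := extChartAt I x with he
  let gh : E → W := g ∘ e.symm
  let O : Set E := e.target ∩ e.symm ⁻¹' U
  have hO : IsOpen O := (continuousOn_extChartAt_symm x).isOpen_inter_preimage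
    (isOpen_extChartAt_target x) hU
  have he₀ : e x ∈ O := ⟨mem_extChartAt_target x, by
    change e.symm (e x) ∈ U; rwa [extChartAt_to_inv]⟩
  have hgh : ContDiffOn ℝ ∞ gh O := by
    rw [← contMDiffOn_iff_contDiffOn]
    exact hg.comp ((contMDiffOn_extChartAt_symm x).mono inter_subset_left) (fun z hz => hz.2)
  have hgd : HasFDerivAt gh (fderiv ℝ gh (e x)) (e x) :=
    ((hgh.contDiffAt (hO.mem_nhds he₀)).differentiableAt (by simp)).hasFDerivAt
  have hA : (fderiv ℝ gh (e x) : E →L[ℝ] W) = mfderiv I 𝓘(ℝ, W) g x := by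
    have hm : MDifferentiableAt I 𝓘(ℝ, W) g x :=
      (hg.contMDiffAt (hU.mem_nhds hx)).mdifferentiableAt (by simp)
    refine Eq.trans ?_ hm.mfderiv.symm
    rw [I.range_eq_univ, fderivWithin_univ]
    rfl
  set A : E →L[ℝ] W := fderiv ℝ gh (e x) with hAdef
  obtain ⟨R, hR⟩ : A.HasRightInverse := by rw [hA]; exact hr
  -- Since `A ∘ R = id`, this map satisfies `A ∘ Φ = gh`, and its derivative at `e x` is the
  -- identity: composing the chart with `Φ` turns `g` into the linear map `A`.
  let Φ : E → E := fun z => z - R (A z) + R (gh z)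
  have hΦ : ContDiffOn ℝ ∞ Φ O :=
    (contDiff_id.sub (R.contDiff.comp A.contDiff)).contDiffOn.add (R.contDiff.comp_contDiffOn hgh)
  have hΦd : HasFDerivAt Φ (ContinuousLinearMap.id ℝ E) (e x) := by
    have := ((hasFDerivAt_id (𝕜 := ℝ) (e x)).sub
      ((R.comp A).hasFDerivAt)).add (R.hasFDerivAt.comp (e x) hgd)
    refine this.congr_fderiv ?_
    ext z; simp
  obtain ⟨ρ, hρx, hρO, hρ, hρs, hρt⟩ :=
    exists_openPartialHomeomorph_of_hasFDerivAt_id hO hΦ he₀ hΦd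
  let T := I.toHomeomorph
  -- Charts take values in `H`, so `ρ` is conjugated by the homeomorphism `H ≃ E` that a
  -- boundaryless model provides.
  let ψ : OpenPartialHomeomorph M H :=
    ((chartAt H x).trans T.toOpenPartialHomeomorph).trans
      (ρ.trans T.symm.toOpenPartialHomeomorph)
  have hsrc : ∀ y, y ∈ ψ.source ↔ y ∈ (chartAt H x).source ∧ e y ∈ ρ.source := by
    intro y; simp [ψ, T, e]
  have hψe : ∀ y, ψ.extend I y = ρ (e y) := by
    intro y
    exact I.right_inv (by rw [I.range_eq_univ]; trivial)
  refine ⟨ψ, ?_, ?_, A, ⟨R, hR⟩, ?_⟩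
  · refine ψ.mem_maximalAtlas_of_contMDiffOn ?_ ?_
    · have h1 : ContMDiffOn I 𝓘(ℝ, E) ∞ e ψ.source :=
        (contMDiffOn_extChartAt (x := x)).mono fun y hy => ((hsrc y).1 hy).1
      have h2 := hρs.contMDiffOn.comp h1 fun y hy => ((hsrc y).1 hy).2
      exact I.contMDiffOn_symm.comp h2 fun y _ => by rw [I.range_eq_univ]; trivial
    · have h1 : ContMDiffOn I 𝓘(ℝ, E) ∞ I ψ.target := I.contMDiff.contMDiffOn
      have h2 := hρt.contMDiffOn.comp h1 fun z hz => by
        simpa [T] using hz.1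
      exact (contMDiffOn_extChartAt_symm x).comp h2 fun z hz => by
        have : I z ∈ ρ.target := by simpa [T] using hz.1
        exact (hρO (ρ.map_target this)).1
  · exact (hsrc x).2 ⟨mem_chart_source H x, hρx⟩
  · intro y hy
    rw [hsrc] at hy
    rw [hψe, hρ]
    have h1 : gh (e y) = g y := by
      simp only [gh, comp]
      rw [(extChartAt I x).left_inv (by rw [extChartAt_source]; exact hy.1)]
    simp only [Φ, map_add, map_sub, hR _, h1]
    simp

end LinearSubmersion

/-! ### Defining functions of submanifolds -/

section DefiningFunctions

variable {E : Type*} [NormedAddCommGroup E] [NormedSpace ℝ E]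
  {H : Type*} [TopologicalSpace H] {I : ModelWithCorners ℝ E H}
  {M : Type*} [TopologicalSpace M] [ChartedSpace H M]
  {W : Type*} [NormedAddCommGroup W] [NormedSpace ℝ W]

/-- If `p'` is the projection onto `V`, then `id - p'` is a surjection onto the complement `ker p'`,
split by the inclusion, with kernel `V`. Closedness of `W` is recorded because it makes `W` complete
when `E` is. -/
theorem IsSubmanifold.exists_isDefiningAt {S : Set M} (hS : IsSubmanifold I S) {x : M}
    (hx : x ∈ S) :
    ∃ W : Submodule ℝ E, IsClosed (W : Set E) ∧ ∃ g : M → W, IsDefiningAt I S g x := by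
  obtain ⟨φ, hφ, hxφ, V, ⟨p, hp⟩, hV⟩ := hS x hx
  let p' : E →L[ℝ] E := V.subtypeL.comp p
  have hp' : ∀ e, p (p e : E) = p e := fun e => hp (p e)
  let q : E →L[ℝ] p'.ker := (ContinuousLinearMap.id ℝ E - p').codRestrict p'.ker fun e => by
    change ((p (e - p e) : V) : E) = 0
    rw [map_sub, hp', sub_self]; rfl
  refine ⟨p'.ker, p'.isClosed_ker, fun y => q (φ.extend I y),
    ⟨φ, hφ, hxφ, q, ⟨p'.ker.subtypeL, ?_⟩, fun _ _ => rfl⟩, ?_⟩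
  · rintro ⟨w, hw⟩
    refine Subtype.ext ?_
    change w - p' w = w
    rw [show p' w = 0 from hw, sub_zero]
  · filter_upwards [φ.open_source.mem_nhds hxφ] with y hy
    rw [hV y hy]
    generalize φ.extend I y = e
    constructor
    · intro he
      refine Subtype.ext ?_
      change e - p' e = 0
      have := hp ⟨e, he⟩
      change p e = _ at this
      change e - (p e : E) = 0
      rw [this, sub_self]
    · intro he
      have h1 : e - (p e : E) = 0 := congrArg Subtype.val he
      rw [sub_eq_zero.1 h1]
      exact (p e).2

/-- In the linearizing chart the zero set is `ker q`, complemented because `q` splits; the chart is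
shrunk to where `S` is the zero set. -/
theorem IsDefiningAt.exists_chart [IsManifold I ∞ M] {S : Set M} {g : M → W} {x : M}
    (h : IsDefiningAt I S g x) :
    ∃ φ ∈ IsManifold.maximalAtlas I ∞ M, x ∈ φ.source ∧
      ∃ V : Submodule ℝ E, V.ClosedComplemented ∧ ∀ y ∈ φ.source, (y ∈ S ↔ φ.extend I y ∈ V) := by
  obtain ⟨⟨ψ, hψ, hxψ, q, hq, hg⟩, hS⟩ := h
  obtain ⟨U, hUS, hU, hxU⟩ := eventually_nhds_iff.1 hS
  refine ⟨ψ.restr U, restr_mem_maximalAtlas _ hψ hU, ?_, q.ker, hq.closedComplemented_ker, ?_⟩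
  · rw [ψ.restr_source' U hU]; exact ⟨hxψ, hxU⟩
  · intro y hy
    rw [ψ.restr_source' U hU] at hy
    rw [hUS y hy.2, hg y hy.1]
    rfl

/-- All tangent spaces are copies of `E`, so vectors at equal base points may be compared there;
this handles the transport in `tangentSub`. -/
theorem eq_cast_of_eq {x y : M} (h : x = y) {w : TangentSpace I x} {v : TangentSpace I y}
    (hwv : (w : E) = v) : v = h ▸ w := by
  subst h; exact hwv.symm

variable [I.Boundaryless]

/-- The tangent space of `S` is the kernel of the derivative of a defining function. -/
theorem IsDefiningAt.tangentSub_eq {S : Set M} {g : M → W} {x : M} (h : IsDefiningAt I S g x)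
    (hx : x ∈ S) : tangentSub I S x = (mfderiv I 𝓘(ℝ, W) g x).ker := by
  have hgm := h.1.mdifferentiableAt
  apply le_antisymm
  · refine Submodule.span_le.2 ?_
    rintro _ ⟨γ, hγ0, hγ, hγS, rfl⟩
    subst hγ0
    have h1 := mfderiv_comp (0 : ℝ) hgm (hγ.mdifferentiableAt (by simp))
    -- A defining function vanishes along any curve in `S`, so it kills the velocity.
    have h2 : g ∘ γ =ᶠ[𝓝 0] fun _ => (0 : W) := by
      filter_upwards [hγS, hγ.continuousAt.eventually h.2] with t ht1 ht2
      exact ht2.1 ht1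
    rw [h2.mfderiv_eq, mfderiv_const] at h1
    exact (congrArg (fun L : ℝ →L[ℝ] W => L 1) h1).symm
  · intro v hv
    obtain ⟨⟨ψ, hψ, hxψ, q, hq, hg⟩, hS⟩ := h
    have hgx : g x = 0 := hS.self_of_nhds.1 hx
    have hx' : ψ.extend I x ∈ (ψ.extend I).target :=
      (ψ.extend I).map_source (by rwa [ψ.extend_source])
    have hopen : IsOpen (ψ.extend I).target := ψ.isOpen_extend_target
    have hψm : MDifferentiableAt I 𝓘(ℝ, E) (ψ.extend I) x :=
      (ψ.contMDiffAt_extend hψ hxψ).mdifferentiableAt (by simp)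
    let A : TangentSpace I x →L[ℝ] E := mfderiv I 𝓘(ℝ, E) (ψ.extend I) x
    -- Conversely, a vector in `ker Dg` is the velocity of the straight line in the linearizing
    -- chart with direction `Dψ(v)`: this direction lies in `ker q`, so the line stays in `S`.
    let l : ℝ → E := fun t => ψ.extend I x + t • A v
    have hl : ContDiff ℝ ∞ l := contDiff_const.add (contDiff_id.smul contDiff_const)
    have hl0 : l 0 = ψ.extend I x := by simp [l]
    have hsymm : ContMDiffAt 𝓘(ℝ, E) I ∞ (ψ.extend I).symm (ψ.extend I x) := by
      refine (contMDiffOn_extend_symm hψ).contMDiffAt ?_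
      rw [← ψ.extend_target']
      exact hopen.mem_nhds hx'
    let γ : ℝ → M := fun t => (ψ.extend I).symm (l t)
    have hinv : (ψ.extend I).symm (ψ.extend I x) = x :=
      (ψ.extend I).left_inv (by rwa [ψ.extend_source])
    have hγ0 : γ 0 = x := by simp only [γ, hl0, hinv]
    have hγ : ContMDiffAt 𝓘(ℝ, ℝ) I ∞ γ 0 :=
      ContMDiffAt.comp (0 : ℝ) (by rw [hl0]; exact hsymm) hl.contMDiff.contMDiffAt
    have hlt : ∀ᶠ t in 𝓝 (0 : ℝ), l t ∈ (ψ.extend I).target :=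
      hl.continuous.continuousAt.eventually (hopen.mem_nhds (by rwa [hl0]))
    have hAq : q (A v) = 0 := by
      have h1 : g =ᶠ[𝓝 x] q ∘ ψ.extend I := by
        filter_upwards [ψ.open_source.mem_nhds hxψ] with y hy using hg y hy
      have h2 := mfderiv_comp x (q.differentiableAt.mdifferentiableAt) hψm
      rw [← h1.mfderiv_eq, mfderiv_eq_fderiv, q.fderiv] at h2
      have h3 := congrArg (fun L : TangentSpace I x →L[ℝ] W => L v) h2
      exact h3.symm.trans hv
    refine Submodule.subset_span ⟨γ, hγ0, hγ, ?_, ?_⟩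
    · filter_upwards [hlt, hγ.continuousAt.eventually (by rw [hγ0]; exact hS)] with t ht hSt
      have h1 := (ψ.extend I).map_target ht
      rw [ψ.extend_source] at h1
      rw [hSt, hg _ h1, (ψ.extend I).right_inv ht]
      simp only [l, map_add, map_smul, hAq, smul_zero, add_zero]
      rw [← hg x hxψ, hgx]
    · have hinvd : (mfderiv 𝓘(ℝ, E) I (ψ.extend I).symm (ψ.extend I x)).comp A =
          ContinuousLinearMap.id ℝ (TangentSpace I x) := by
        have h1 := mfderiv_comp x (hsymm.mdifferentiableAt (by simp)) hψm
        have h2 : (ψ.extend I).symm ∘ ψ.extend I =ᶠ[𝓝 x] id := by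
          filter_upwards [ψ.open_source.mem_nhds hxψ] with y hy
          exact (ψ.extend I).left_inv (by rwa [ψ.extend_source])
        rw [h2.mfderiv_eq, mfderiv_id] at h1
        exact h1.symm
      have hld : HasFDerivAt l (ContinuousLinearMap.toSpanSingleton ℝ (A v)) 0 := by
        have h1 : HasDerivAt l (A v) 0 := by
          have h2 := ((hasDerivAt_id (0 : ℝ)).smul_const (A v)).const_add (ψ.extend I x)
          rwa [one_smul] at h2
        exact h1.hasFDerivAt
      let D : E → E →L[ℝ] E := fun z => mfderiv 𝓘(ℝ, E) I (ψ.extend I).symm z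
      have h1 := mfderiv_comp (0 : ℝ) (by rw [hl0]; exact hsymm.mdifferentiableAt (by simp))
        (hl.contMDiff.contMDiffAt.mdifferentiableAt (by simp))
      rw [mfderiv_eq_fderiv, hld.fderiv] at h1
      have h2 : (mfderiv 𝓘(ℝ, ℝ) I γ 0 (1 : ℝ) : E) = D (l 0) ((1 : ℝ) • A v) :=
        congrArg (fun L : ℝ →L[ℝ] E => L 1) h1
      rw [hl0, one_smul] at h2
      exact eq_cast_of_eq hγ0 (h2.trans (congrArg (fun L : E →L[ℝ] E => L v) hinvd))

end DefiningFunctions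

/-! ### Transversality in terms of defining functions -/

section Transversality

variable {E : Type*} [NormedAddCommGroup E] [NormedSpace ℝ E] [CompleteSpace E]
  {H : Type*} [TopologicalSpace H] {I : ModelWithCorners ℝ E H} [I.Boundaryless]
  {M : Type*} [TopologicalSpace M] [ChartedSpace H M] [IsManifold I ∞ M]
  {E' : Type*} [NormedAddCommGroup E'] [NormedSpace ℝ E']
  {H' : Type*} [TopologicalSpace H'] {J : ModelWithCorners ℝ E' H'} [J.Boundaryless]
  {N : Type*} [TopologicalSpace N] [ChartedSpace H' N]
  {W : Type*} [NormedAddCommGroup W] [NormedSpace ℝ W]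

/-- A map is transverse to `S` at `x` iff its composition with a defining function is a split
submersion. -/
theorem IsDefiningAt.transverse_iff [CompleteSpace W] {S : Set N} {f : M → N} {x : M} {g : N → W}
    (hf : ContMDiff I J ∞ f) (hx : f x ∈ S) (hg : IsDefiningAt J S g (f x)) :
    ((mfderiv I J f x).range ⊔ tangentSub J S (f x) = ⊤ ∧
      ((tangentSub J S (f x)).comap (mfderiv I J f x).toLinearMap).ClosedComplemented) ↔
    (mfderiv I 𝓘(ℝ, W) (g ∘ f) x).HasRightInverse := by
  have hcomp := mfderiv_comp x hg.1.mdifferentiableAt ((hf x).mdifferentiableAt (by simp))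
  obtain ⟨R, hR⟩ := hg.1.hasRightInverse_mfderiv
  rw [hg.tangentSub_eq hx]
  let A : E →L[ℝ] E' := mfderiv I J f x
  let B : E' →L[ℝ] W := mfderiv J 𝓘(ℝ, W) g (f x)
  let C : E →L[ℝ] W := mfderiv I 𝓘(ℝ, W) (g ∘ f) x
  let R' : W →L[ℝ] E' := R
  replace hR : ∀ w, B (R' w) = w := hR
  have hC : ∀ v, C v = B (A v) := fun v => congrArg (fun L : E →L[ℝ] W => L v) hcomp
  -- The space required to be complemented is exactly the kernel of `D(g ∘ f)`.
  have hker : C.ker = B.ker.comap A.toLinearMap := by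
    ext v; exact Eq.congr_left (hC v)
  change (A.range ⊔ B.ker = ⊤ ∧ (B.ker.comap A.toLinearMap).ClosedComplemented) ↔
    C.HasRightInverse
  rw [← hker]
  constructor
  · rintro ⟨h1, h2⟩
    refine ContinuousLinearMap.hasRightInverse_of_closedComplemented_ker (fun w => ?_) h2
    -- Writing the lift `R' w` of `w` as `A v + k` with `B k = 0` gives `C v = w`, so `C` is
    -- surjective.
    have h3 : R' w ∈ A.range ⊔ B.ker := by rw [h1]; trivial
    obtain ⟨_, ⟨v, rfl⟩, k, hk, hvk⟩ := Submodule.mem_sup.1 h3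
    refine ⟨v, ?_⟩
    have h4 := congrArg B hvk
    rw [hR, map_add, show B k = 0 from hk, add_zero] at h4
    exact (hC v).trans h4
  · intro h
    refine ⟨?_, h.closedComplemented_ker⟩
    obtain ⟨Q, hQ⟩ := h
    -- `A (Q (B u))` has the same image under `B` as `u`, so the difference lies in `ker B`, the
    -- tangent space of `S`.
    refine (Submodule.eq_top_iff').2 fun u => Submodule.mem_sup.2
      ⟨A (Q (B u)), ⟨_, rfl⟩, u - A (Q (B u)), ?_, by abel⟩
    change B (u - A (Q (B u))) = 0
    rw [map_sub, ← hC, hQ, sub_self]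

theorem IsDefiningAt.comp_of_hasRightInverse {S : Set N} {f : M → N} {x : M} {g : N → W}
    (hf : ContMDiff I J ∞ f) (hg : IsDefiningAt J S g (f x))
    (h : (mfderiv I 𝓘(ℝ, W) (g ∘ f) x).HasRightInverse) :
    IsDefiningAt I (f ⁻¹' S) (g ∘ f) x := by
  obtain ⟨U, hU, hxU, hgU⟩ := hg.1.exists_contMDiffOn
  refine ⟨isLinearSubmersionAt_of_hasRightInverse (hU.preimage hf.continuous) hxU
    (hgU.comp hf.contMDiffOn fun y hy => hy) h, ?_⟩
  exact hf.continuous.continuousAt.eventually hg.2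

theorem IsDefiningAt.comp_of_isTransverse [CompleteSpace W] {S : Set N} {f : M → N} {x : M}
    {g : N → W} (hf : ContMDiff I J ∞ f) (hx : f x ∈ S) (hg : IsDefiningAt J S g (f x))
    (h : IsTransverse I J f S) : IsDefiningAt I (f ⁻¹' S) (g ∘ f) x :=
  hg.comp_of_hasRightInverse hf ((hg.transverse_iff hf hx).1 (h x hx))

variable [CompleteSpace E']

theorem IsSubmanifold.exists_isDefiningAt_comp {S : Set N} (hS : IsSubmanifold J S) {f : M → N}
    (hf : ContMDiff I J ∞ f) (h : IsTransverse I J f S) {x : M} (hx : f x ∈ S) :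
    ∃ W : Submodule ℝ E', IsClosed (W : Set E') ∧ ∃ g : N → W, IsDefiningAt J S g (f x) ∧
      IsDefiningAt I (f ⁻¹' S) (g ∘ f) x := by
  obtain ⟨W, hW, g, hg⟩ := hS.exists_isDefiningAt hx
  have : CompleteSpace W := hW.completeSpace_coe
  exact ⟨W, hW, g, hg, hg.comp_of_isTransverse hf hx h⟩

theorem IsTransverse.isSubmanifold_preimage {S : Set N} {f : M → N} (h : IsTransverse I J f S)
    (hf : ContMDiff I J ∞ f) (hS : IsSubmanifold J S) : IsSubmanifold I (f ⁻¹' S) := fun x hx => by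
  obtain ⟨W, hW, g, hg, hgf⟩ := hS.exists_isDefiningAt_comp hf h hx
  exact hgf.exists_chart

/-- A map is transverse to `S` if its compositions with the defining functions of `S` have split
surjective derivative. -/
theorem IsSubmanifold.isTransverse_of_hasRightInverse {S : Set N} (hS : IsSubmanifold J S)
    {f : M → N} (hf : ContMDiff I J ∞ f)
    (h : ∀ x, f x ∈ S → ∀ (W : Submodule ℝ E') (g : N → W), CompleteSpace W →
      IsDefiningAt J S g (f x) → (mfderiv I 𝓘(ℝ, W) (g ∘ f) x).HasRightInverse) :
    IsTransverse I J f S := fun x hx => by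
  obtain ⟨W, hW, g, hg⟩ := hS.exists_isDefiningAt hx
  have : CompleteSpace W := hW.completeSpace_coe
  exact (hg.transverse_iff hf hx).2 (h x hx W g this hg)

/-- The tangent space of the preimage of `S` under a transverse map. -/
theorem IsTransverse.tangentSub_preimage {S : Set N} {f : M → N} (h : IsTransverse I J f S)
    (hf : ContMDiff I J ∞ f) (hS : IsSubmanifold J S) {x : M} (hx : f x ∈ S) :
    tangentSub I (f ⁻¹' S) x =
      (tangentSub J S (f x)).comap (mfderiv I J f x).toLinearMap := by
  obtain ⟨W, hW, g, hg, hgf⟩ := hS.exists_isDefiningAt_comp hf h hx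
  rw [hg.tangentSub_eq hx, hgf.tangentSub_eq hx,
    mfderiv_comp x hg.1.mdifferentiableAt ((hf x).mdifferentiableAt (by simp))]
  rfl

end Transversality

/-! ### Tangent bundles of submanifolds -/

section TangentBundles

variable {E : Type*} [NormedAddCommGroup E] [NormedSpace ℝ E]
  {H : Type*} [TopologicalSpace H] {I : ModelWithCorners ℝ E H}
  {M : Type*} [TopologicalSpace M] [ChartedSpace H M]
  {E' : Type*} [NormedAddCommGroup E'] [NormedSpace ℝ E']
  {H' : Type*} [TopologicalSpace H'] {J : ModelWithCorners ℝ E' H'} [J.Boundaryless]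
  {N : Type*} [TopologicalSpace N] [ChartedSpace H' N]
  {W : Type*} [NormedAddCommGroup W] [NormedSpace ℝ W]

variable (I) in
/-- The tangent map `TM → W × W` of a vector-valued map. -/
def tangentProdMap (g : M → W) (p : TangentBundle I M) : W × W :=
  (g p.1, mfderiv I 𝓘(ℝ, W) g p.1 p.2)

theorem ContMDiffOn.tangentProdMap [IsManifold I ∞ M] {g : M → W} {U : Set M} (hU : IsOpen U)
    (hg : ContMDiffOn I 𝓘(ℝ, W) ∞ g U) :
    ContMDiffOn I.tangent 𝓘(ℝ, W × W) ∞ (tangentProdMap I g)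
      (π E (TangentSpace I) ⁻¹' U) := by
  have : IsManifold I 1 M := IsManifold.of_le (n := ∞) (by simp)
  have h1 := hg.contMDiffOn_tangentMapWithin (m := ∞) (by simp) hU.uniqueMDiffOn
  have h2 := (contMDiff_snd_tangentBundle_modelSpace W 𝓘(ℝ, W) (n := ∞)).comp_contMDiffOn h1
  have h3 : ContMDiffOn I.tangent 𝓘(ℝ, W) ∞ (fun p : TangentBundle I M => g p.1)
      (π E (TangentSpace I) ⁻¹' U) :=
    hg.comp (Bundle.contMDiff_proj (TangentSpace I)).contMDiffOn (fun p hp => hp)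
  refine (h3.prodMk_space h2).congr fun p hp => ?_
  refine Prod.ext rfl ?_
  change mfderiv I 𝓘(ℝ, W) g p.1 p.2 = mfderivWithin I 𝓘(ℝ, W) g U p.1 p.2
  rw [mfderivWithin_of_isOpen hU hp]

theorem tangentMap_eq_self_of_eventuallyEq_id {f : M → M} {p : TangentBundle I M}
    (h : f =ᶠ[𝓝 p.1] id) : tangentMap I I f p = p := by
  refine TotalSpace.ext h.self_of_nhds (heq_of_eq ?_)
  have h1 : mfderiv I I f p.1 = mfderiv I I id p.1 := h.mfderiv_eq
  rw [mfderiv_id] at h1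
  exact congrArg (fun L : E →L[ℝ] E => L p.2) h1

variable [I.Boundaryless] [CompleteSpace E] [IsManifold I ∞ M]

/-- As for `g` itself, a local section suffices: lift `(w₁, w₂)` to the vector `Dψ(v) + R w₂` at the
point `ψ x + R w₁` and carry it to `TM` by the tangent map of `ψ⁻¹`. There `(g, Dg)` takes the value
`(q c + w₁, q d + w₂)`. -/
theorem IsLinearSubmersionAt.tangentProdMap {g : M → W} {p : TangentBundle I M}
    (h : IsLinearSubmersionAt I g p.1) :
    IsLinearSubmersionAt I.tangent (tangentProdMap I g) p := by
  obtain ⟨U, hU, hpU, hgU⟩ := h.exists_contMDiffOn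
  have hUT : IsOpen (π E (TangentSpace I) ⁻¹' U : Set (TangentBundle I M)) :=
    hU.preimage (FiberBundle.continuous_proj E (TangentSpace I))
  have hT := hgU.tangentProdMap hU
  refine isLinearSubmersionAt_of_hasRightInverse hUT hpU hT ?_
  have hTp := (hT.contMDiffAt (hUT.mem_nhds hpU)).mdifferentiableAt (by simp)
  obtain ⟨ψ, hψ, hx, q, ⟨R, hR⟩, hg⟩ := h
  obtain ⟨x, v⟩ := p
  change x ∈ ψ.source at hx
  have hx' : ψ.extend I x ∈ (ψ.extend I).target :=
    (ψ.extend I).map_source (by rwa [ψ.extend_source])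
  have hopen : IsOpen (ψ.extend I).target := ψ.isOpen_extend_target
  have hsymm : ContMDiffOn 𝓘(ℝ, E) I ∞ (ψ.extend I).symm (ψ.extend I).target := by
    rw [ψ.extend_target']; exact contMDiffOn_extend_symm hψ
  have hψm : MDifferentiableAt I 𝓘(ℝ, E) (ψ.extend I) x :=
      (ψ.contMDiffAt_extend hψ hx).mdifferentiableAt (by simp)
  let d : E := mfderiv I 𝓘(ℝ, E) (ψ.extend I) x v
  let c : E := ψ.extend I x
  let a : W × W → TangentBundle 𝓘(ℝ, E) E := fun w => ⟨c + R w.1, d + R w.2⟩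
  have ha : ContMDiff 𝓘(ℝ, W × W) 𝓘(ℝ, E).tangent ∞ a := by
    have h1 : ContDiff ℝ ∞ (fun w : W × W => c + R w.1) :=
      contDiff_const.add (R.contDiff.comp contDiff_fst)
    have h2 : ContDiff ℝ ∞ (fun w : W × W => d + R w.2) :=
      contDiff_const.add (R.contDiff.comp contDiff_snd)
    intro w
    refine Bundle.contMDiffAt_totalSpace.2 ⟨h1.contMDiff w, ?_⟩
    have h3 : (fun w => (trivializationAt E (TangentSpace 𝓘(ℝ, E)) (a w).proj (a w)).2) =
      (fun w : W × W => d + R w.2) := by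
      ext w; simp [a]
    simpa [a] using h2.contMDiff w
  let s : W × W → TangentBundle I M := fun w => tangentMap 𝓘(ℝ, E) I (ψ.extend I).symm (a w)
  have ha0 : a 0 = tangentMap I 𝓘(ℝ, E) (ψ.extend I) ⟨x, v⟩ := by
    refine congrArg₂ (fun z u : E => (⟨z, u⟩ : TangentBundle 𝓘(ℝ, E) E))
      (show c + R (0 : W) = c by simp) (show d + R (0 : W) = d by simp)
  have : IsManifold I 1 M := IsManifold.of_le (n := ∞) (by simp)
  have hs : ContMDiffAt 𝓘(ℝ, W × W) I.tangent ∞ s 0 := by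
    have h1 := hsymm.contMDiffOn_tangentMapWithin (m := ∞) (by simp) hopen.uniqueMDiffOn
    have h2 : ContMDiffOn 𝓘(ℝ, E).tangent I.tangent ∞ (tangentMap 𝓘(ℝ, E) I (ψ.extend I).symm)
        (π E (TangentSpace 𝓘(ℝ, E)) ⁻¹' (ψ.extend I).target) := by
      refine h1.congr fun z hz => ?_
      exact (tangentMapWithin_eq_tangentMap (hopen.uniqueMDiffOn _ hz)
        ((hsymm.contMDiffAt (hopen.mem_nhds hz)).mdifferentiableAt (by simp))).symm
    refine (h2.contMDiffAt ?_).comp 0 ha.contMDiffAt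
    refine (hopen.preimage (FiberBundle.continuous_proj E (TangentSpace 𝓘(ℝ, E)))).mem_nhds ?_
    rw [ha0]; exact hx'
  have hs0 : s 0 = ⟨x, v⟩ := by
    have h1 := tangentMap_comp_at (I := I) (⟨x, v⟩ : TangentBundle I M)
      ((hsymm.contMDiffAt (hopen.mem_nhds hx')).mdifferentiableAt (by simp)) hψm
    change tangentMap 𝓘(ℝ, E) I (ψ.extend I).symm (a 0) = _
    rw [ha0, ← h1]
    refine tangentMap_eq_self_of_eventuallyEq_id ?_
    filter_upwards [ψ.open_source.mem_nhds hx] with y hy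
    exact (ψ.extend I).left_inv (by rwa [ψ.extend_source])
  have := hasRightInverse_mfderiv_of_section (I := I.tangent) (g := _root_.tangentProdMap I g)
    (s := s) (w₀ := 0) (c := (q c, q d)) (by rwa [hs0]) (hs.mdifferentiableAt (by simp)) ?_
  · rwa [hs0] at this
  · have h0 : ∀ᶠ w in 𝓝 (0 : W × W), (a w).proj ∈ (ψ.extend I).target := by
      have h1 : Continuous fun w => (a w).proj :=
        (FiberBundle.continuous_proj E (TangentSpace 𝓘(ℝ, E))).comp ha.continuous
      refine h1.continuousAt.eventually (hopen.mem_nhds ?_)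
      change (a 0).proj ∈ _
      rw [ha0]; exact hx'
    filter_upwards [h0] with w hw
    have h1 : ∀ z ∈ (ψ.extend I).target, g ((ψ.extend I).symm z) = q z := by
      intro z hz
      have h2 := (ψ.extend I).map_target hz
      rw [ψ.extend_source] at h2
      rw [hg _ h2, (ψ.extend I).right_inv hz]
    have h2 : g ∘ (ψ.extend I).symm =ᶠ[𝓝 (a w).proj] q := by
      filter_upwards [hopen.mem_nhds hw] with z hz using h1 z hz
    have h3 : MDifferentiableAt I 𝓘(ℝ, W) g ((ψ.extend I).symm (a w).proj) := by
      refine IsLinearSubmersionAt.mdifferentiableAt ⟨ψ, hψ, ?_, q, ⟨R, hR⟩, hg⟩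
      have h4 := (ψ.extend I).map_target hw
      rwa [ψ.extend_source] at h4
    have h4 := mfderiv_comp (a w).proj h3
      ((hsymm.contMDiffAt (hopen.mem_nhds hw)).mdifferentiableAt (by simp))
    rw [h2.mfderiv_eq, mfderiv_eq_fderiv, q.fderiv] at h4
    refine Prod.ext ?_ ?_
    · refine (h1 _ hw).trans ?_
      change q (c + R w.1) = q c + w.1
      rw [map_add, hR]
    · refine (congrArg (fun L : E →L[ℝ] W => L (d + R w.2)) h4).symm.trans ?_
      change q (d + R w.2) = q d + w.2
      rw [map_add, hR]

/-- `TS` is locally the zero set of the tangent map of a defining function of `S`. -/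
theorem IsDefiningAt.tangentProdMap {S : Set M} {g : M → W} {p : TangentBundle I M}
    (h : IsDefiningAt I S g p.1) :
    IsDefiningAt I.tangent (tangentSubset I S) (tangentProdMap I g) p := by
  refine ⟨h.1.tangentProdMap, ?_⟩
  -- `g` is a defining function at all base points near `p.1`, so `TS = ker Dg` holds on the nearby
  -- fibres over `S` too.
  have h1 := ((FiberBundle.continuous_proj E (TangentSpace I)).tendsto p).eventually h.eventually
  filter_upwards [h1] with z hz
  have h2 : z.1 ∈ S ↔ g z.1 = 0 := hz.2.self_of_nhds
  change (z.1 ∈ S ∧ z.2 ∈ tangentSub I S z.1) ↔ (g z.1, mfderiv I 𝓘(ℝ, W) g z.1 z.2) = 0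
  rw [Prod.mk_eq_zero, ← h2]
  refine and_congr_right fun hzS => ?_
  rw [hz.tangentSub_eq hzS]
  rfl

theorem IsSubmanifold.tangentSubset {S : Set M} (hS : IsSubmanifold I S) :
    IsSubmanifold I.tangent (tangentSubset I S) := fun p hp => by
  obtain ⟨W, hW, g, hg⟩ := hS.exists_isDefiningAt hp.1
  exact hg.tangentProdMap.exists_chart

variable [CompleteSpace E'] [IsManifold J ∞ N]

theorem IsTransverse.tangentMap_preimage {S : Set N} {f : M → N} (h : IsTransverse I J f S)
    (hf : ContMDiff I J ∞ f) (hS : IsSubmanifold J S) :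
    tangentMap I J f ⁻¹' tangentSubset J S = tangentSubset I (f ⁻¹' S) := by
  ext p
  change (f p.1 ∈ S ∧ mfderiv I J f p.1 p.2 ∈ tangentSub J S (f p.1)) ↔
    (f p.1 ∈ S ∧ p.2 ∈ tangentSub I (f ⁻¹' S) p.1)
  refine and_congr_right fun hp => ?_
  rw [h.tangentSub_preimage hf hS hp]
  rfl

/-- By the chain rule the defining function `(g, Dg)` of `TS`, composed with `Df`, is near `p` the
tangent map of `g ∘ f`, which is a submersion because `g ∘ f` is one. -/
theorem IsTransverse.tangentMap {S : Set N} {f : M → N} (h : IsTransverse I J f S)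
    (hf : ContMDiff I J ∞ f) (hS : IsSubmanifold J S) :
    IsTransverse I.tangent J.tangent (tangentMap I J f) (tangentSubset J S) := fun p hp => by
  have : IsManifold I 1 M := IsManifold.of_le (n := ∞) (by simp)
  have : IsManifold J 1 N := IsManifold.of_le (n := ∞) (by simp)
  obtain ⟨W, hW, g, hg, hgf⟩ := hS.exists_isDefiningAt_comp hf h hp.1
  have : CompleteSpace W := hW.completeSpace_coe
  have hG : IsDefiningAt J.tangent (tangentSubset J S) (_root_.tangentProdMap J g)
    (_root_.tangentMap I J f p) := IsDefiningAt.tangentProdMap hg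
  refine (hG.transverse_iff (hf.contMDiff_tangentMap (m := ∞) (by simp)) hp).2 ?_
  have hGf : IsLinearSubmersionAt I.tangent (_root_.tangentProdMap I (g ∘ f)) p :=
    hgf.1.tangentProdMap
  have heq : _root_.tangentProdMap J g ∘ _root_.tangentMap I J f =ᶠ[𝓝 p]
      _root_.tangentProdMap I (g ∘ f) := by
    have h1 := ((hf.continuous.comp
      (FiberBundle.continuous_proj E (TangentSpace I))).tendsto p).eventually hg.1.eventually
    filter_upwards [h1] with z hz
    refine Prod.ext rfl ?_
    have h2 := mfderiv_comp z.1 (IsLinearSubmersionAt.mdifferentiableAt hz)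
      ((hf z.1).mdifferentiableAt (by simp))
    exact (congrArg (fun L : E →L[ℝ] W => L z.2) h2).symm
  rw [heq.mfderiv_eq]
  exact hGf.hasRightInverse_mfderiv

end TangentBundles

/-! ### Vector bundle projections -/

section Projections

variable {E₀ : Type*} [NormedAddCommGroup E₀] [NormedSpace ℝ E₀]
  {H : Type*} [TopologicalSpace H] {I : ModelWithCorners ℝ E₀ H}
  {B : Type*} [TopologicalSpace B] [ChartedSpace H B]
  {F : Type*} [NormedAddCommGroup F] [NormedSpace ℝ F]
  {V : B → Type*} [∀ x, AddCommGroup (V x)] [∀ x, Module ℝ (V x)]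
  [∀ x, TopologicalSpace (V x)] [TopologicalSpace (TotalSpace F V)] [FiberBundle F V]
  [VectorBundle ℝ F V] [ContMDiffVectorBundle ∞ F V I] [IsManifold I ∞ B]
  {W : Type*} [NormedAddCommGroup W] [NormedSpace ℝ W]

/-- The section through `p` that is constant in a local trivialization splits the derivative of the
projection. -/
theorem hasRightInverse_mfderiv_proj (p : TotalSpace F V) :
    (mfderiv (I.prod 𝓘(ℝ, F)) I (π F V) p).HasRightInverse := by
  let t := trivializationAt F V p.1
  have hp : p.1 ∈ t.baseSet := mem_baseSet_trivializationAt F V p.1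
  have hpt : p ∈ t.source := t.mem_source.2 hp
  let s : B → TotalSpace F V := fun y => t.toOpenPartialHomeomorph.symm (y, (t p).2)
  have hs0 : s p.1 = p := by
    have h1 : (p.1, (t p).2) = t p := t.mk_proj_snd hpt
    simp only [s, h1]
    exact t.toOpenPartialHomeomorph.left_inv hpt
  have htp : (p.1, (t p).2) ∈ t.target := t.mem_target.2 hp
  have hs : MDifferentiableAt I (I.prod 𝓘(ℝ, F)) s p.1 := by
    have h1 : ContMDiffAt (I.prod 𝓘(ℝ, F)) (I.prod 𝓘(ℝ, F)) ∞ t.toOpenPartialHomeomorph.symm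
        (p.1, (t p).2) :=
      (t.contMDiffOn_symm (IB := I)).contMDiffAt (t.open_target.mem_nhds htp)
    have h2 : ContMDiffAt I (I.prod 𝓘(ℝ, F)) ∞ (fun y : B => (y, (t p).2)) p.1 :=
      contMDiffAt_id.prodMk contMDiffAt_const
    exact (h1.comp p.1 h2).mdifferentiableAt (by simp)
  have hπ : MDifferentiableAt (I.prod 𝓘(ℝ, F)) I (π F V) (s p.1) :=
    (Bundle.contMDiff_proj (n := ∞) V _).mdifferentiableAt (by simp)
  have h1 := mfderiv_comp p.1 hπ hs
  have h2 : π F V ∘ s =ᶠ[𝓝 p.1] id := by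
    filter_upwards [t.open_baseSet.mem_nhds hp] with y hy
    exact t.proj_symm_apply (t.mem_target.2 hy)
  rw [h2.mfderiv_eq, mfderiv_id] at h1
  have h3 : (mfderiv (I.prod 𝓘(ℝ, F)) I (π F V) (s p.1)).HasRightInverse :=
    ⟨mfderiv I (I.prod 𝓘(ℝ, F)) s p.1, fun v =>
      (congrArg (fun L : E₀ →L[ℝ] E₀ => L v) h1).symm⟩
  rwa [hs0] at h3

theorem hasRightInverse_mfderiv_comp_proj {g : B → W} {p : TotalSpace F V}
    (hg : MDifferentiableAt I 𝓘(ℝ, W) g p.1) (h : (mfderiv I 𝓘(ℝ, W) g p.1).HasRightInverse) :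
    (mfderiv (I.prod 𝓘(ℝ, F)) 𝓘(ℝ, W) (g ∘ π F V) p).HasRightInverse := by
  rw [mfderiv_comp p hg ((Bundle.contMDiff_proj (n := ∞) V p).mdifferentiableAt (by simp))]
  exact h.comp (hasRightInverse_mfderiv_proj p)

variable [I.Boundaryless] [CompleteSpace E₀] [CompleteSpace F]

theorem IsSubmanifold.isTransverse_proj {S : Set B} (hS : IsSubmanifold I S) :
    IsTransverse (I.prod 𝓘(ℝ, F)) I (π F V) S :=
  hS.isTransverse_of_hasRightInverse (Bundle.contMDiff_proj V) fun _ _ _ _ _ hg =>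
    hasRightInverse_mfderiv_comp_proj hg.1.mdifferentiableAt hg.1.hasRightInverse_mfderiv

/-- The restriction of a vector bundle to a submanifold of its base is a submanifold. -/
theorem IsSubmanifold.proj_preimage {S : Set B} (hS : IsSubmanifold I S) :
    IsSubmanifold (I.prod 𝓘(ℝ, F)) (π F V ⁻¹' S) :=
  hS.isTransverse_proj.isSubmanifold_preimage (Bundle.contMDiff_proj V) hS

/-- A bundle map is transverse to the restriction of the target to `S`, if the map of the bases is
transverse to `S`. -/
theorem IsTransverse.proj_preimage {E₀' : Type*} [NormedAddCommGroup E₀'] [NormedSpace ℝ E₀']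
    {H' : Type*} [TopologicalSpace H'] {J : ModelWithCorners ℝ E₀' H'}
    {B' : Type*} [TopologicalSpace B'] [ChartedSpace H' B']
    {F' : Type*} [NormedAddCommGroup F'] [NormedSpace ℝ F']
    {V' : B' → Type*} [∀ x, AddCommGroup (V' x)] [∀ x, Module ℝ (V' x)]
    [∀ x, TopologicalSpace (V' x)] [TopologicalSpace (TotalSpace F' V')] [FiberBundle F' V']
    [VectorBundle ℝ F' V'] [ContMDiffVectorBundle ∞ F' V' J] [IsManifold J ∞ B']
    [J.Boundaryless] [CompleteSpace E₀'] [CompleteSpace F']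
    {f₀ : B → B'} {f : TotalSpace F V → TotalSpace F' V'} (hf₀ : ContMDiff I J ∞ f₀)
    (hf : ContMDiff (I.prod 𝓘(ℝ, F)) (J.prod 𝓘(ℝ, F')) ∞ f) (hcomm : ∀ p, (f p).1 = f₀ p.1)
    {S : Set B'} (hS : IsSubmanifold J S) (h : IsTransverse I J f₀ S) :
    IsTransverse (I.prod 𝓘(ℝ, F)) (J.prod 𝓘(ℝ, F')) f (π F' V' ⁻¹' S) := by
  intro p hp
  have hp' : f₀ p.1 ∈ S := by rw [← hcomm]; exact hp
  obtain ⟨W, hW, g, hg, hgf⟩ := hS.exists_isDefiningAt_comp hf₀ h hp'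
  have : CompleteSpace W := hW.completeSpace_coe
  rw [← hcomm] at hg
  have hgπ : IsDefiningAt (J.prod 𝓘(ℝ, F')) (π F' V' ⁻¹' S) (g ∘ π F' V') (f p) :=
    IsDefiningAt.comp_of_isTransverse (Bundle.contMDiff_proj V') hp hg hS.isTransverse_proj
  refine (hgπ.transverse_iff hf hp).2 ?_
  -- The defining function `g ∘ π` ignores the fibre, so only `f₀` matters.
  have h1 : (g ∘ π F' V') ∘ f = (g ∘ f₀) ∘ π F V := funext fun z => congrArg g (hcomm z)
  rw [h1]
  exact hasRightInverse_mfderiv_comp_proj hgf.1.mdifferentiableAt hgf.1.hasRightInverse_mfderiv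

end Projections

/-! ### Normal bundles -/

namespace BanachPair

section SubPair

variable {E₀ F E M₀ M : Type*}
  [NormedAddCommGroup E₀] [NormedSpace ℝ E₀] [NormedAddCommGroup F] [NormedSpace ℝ F]
  [NormedAddCommGroup E] [NormedSpace ℝ E]
  [TopologicalSpace M₀] [ChartedSpace E₀ M₀] [TopologicalSpace M] [ChartedSpace E M]
  (P : BanachPair E₀ F E M₀ M) {S : Set M} {S₀ : Set M₀}

/-- The hypothesis reads `TS₀ = TS ∩ TM₀`: a vector of `TS` that vanishes modulo `TM₀` already
vanishes modulo `TS₀`. -/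
theorem subNormalMap_injective {x : M₀} (h : tangentSub 𝓘(ℝ, E₀) S₀ x =
    (tangentSub 𝓘(ℝ, E) S (P.incl x)).comap (mfderiv 𝓘(ℝ, E₀) 𝓘(ℝ, E) P.incl x).toLinearMap) :
    Injective (P.subNormalMap S S₀ x) := by
  refine (injective_iff_map_eq_zero _).2 fun X hX => ?_
  induction X using Submodule.Quotient.induction_on with
  | _ X =>
    obtain ⟨w, hw⟩ := (Submodule.Quotient.mk_eq_zero _).1 hX
    refine (Submodule.Quotient.mk_eq_zero _).2 ⟨w, ?_, hw⟩
    rw [h]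
    change mfderiv 𝓘(ℝ, E₀) 𝓘(ℝ, E) P.incl x w ∈ tangentSub 𝓘(ℝ, E) S (P.incl x)
    exact hw ▸ X.2

/-- In a decomposition `X = u + v` with `u` tangent to `M₀` and `v` tangent to `S`, the vector `v`
represents the class of `X`. -/
theorem subNormalMap_surjective {x : M₀}
    (h : P.tangentRange x ⊔ tangentSub 𝓘(ℝ, E) S (P.incl x) = ⊤) :
    Surjective (P.subNormalMap S S₀ x) := by
  intro X
  induction X using Submodule.Quotient.induction_on with
  | _ X =>
    have hX : X ∈ P.tangentRange x ⊔ tangentSub 𝓘(ℝ, E) S (P.incl x) := by rw [h]; trivial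
    obtain ⟨u, hu, v, hv, rfl⟩ := Submodule.mem_sup.1 hX
    refine ⟨Submodule.Quotient.mk ⟨v, hv⟩, (Submodule.Quotient.eq _).2 ?_⟩
    change v - (u + v) ∈ P.tangentRange x
    rw [sub_add_cancel_right]
    exact neg_mem hu

theorem subNormalIncl_injective (h : ∀ x ∈ S₀, tangentSub 𝓘(ℝ, E₀) S₀ x =
    (tangentSub 𝓘(ℝ, E) S (P.incl x)).comap (mfderiv 𝓘(ℝ, E₀) 𝓘(ℝ, E) P.incl x).toLinearMap) :
    Injective (P.subNormalIncl S S₀) := by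
  rintro ⟨⟨x, hx⟩, X⟩ ⟨⟨y, hy⟩, Y⟩ hXY
  obtain rfl : x = y := congrArg TotalSpace.proj hXY
  exact congrArg (Sigma.mk (⟨x, hx⟩ : S₀))
    (P.subNormalMap_injective (h x hx) (eq_of_heq (TotalSpace.mk.inj hXY).2))

/-- If `S` is transverse to `M₀`, then `ν(S, S₀)` is the restriction of `ν(M, M₀)` to `S₀`. -/
theorem range_subNormalIncl
    (h : ∀ x ∈ S₀, P.tangentRange x ⊔ tangentSub 𝓘(ℝ, E) S (P.incl x) = ⊤) :
    range (P.subNormalIncl S S₀) = π F P.NormalSpace ⁻¹' S₀ := by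
  ext ⟨x, X⟩
  constructor
  · rintro ⟨⟨⟨y, hy⟩, Y⟩, hY⟩
    obtain rfl : y = x := congrArg TotalSpace.proj hY
    exact hy
  · intro hx
    obtain ⟨Y, hY⟩ := P.subNormalMap_surjective (h x hx) X
    exact ⟨⟨⟨x, hx⟩, Y⟩, congrArg (TotalSpace.mk x) hY⟩

end SubPair

end BanachPair

/-! ### The map `f_*` in charts, and the tangent spaces of the preimage pair -/

namespace BanachPair.Hom

variable {E₀ F E M₀ M E₀' F' E' N₀ N : Type*}
  [NormedAddCommGroup E₀] [NormedSpace ℝ E₀] [NormedAddCommGroup F] [NormedSpace ℝ F]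
  [NormedAddCommGroup E] [NormedSpace ℝ E]
  [TopologicalSpace M₀] [ChartedSpace E₀ M₀] [TopologicalSpace M] [ChartedSpace E M]
  [NormedAddCommGroup E₀'] [NormedSpace ℝ E₀'] [NormedAddCommGroup F'] [NormedSpace ℝ F']
  [NormedAddCommGroup E'] [NormedSpace ℝ E']
  [TopologicalSpace N₀] [ChartedSpace E₀' N₀] [TopologicalSpace N] [ChartedSpace E' N]
  {P : BanachPair E₀ F E M₀ M} {Q : BanachPair E₀' F' E' N₀ N} (f : P.Hom Q)

theorem derivAt_apply (x : M₀) (v : TangentSpace 𝓘(ℝ, E) (P.incl x)) :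
    (f.derivAt x v : E') = mfderiv 𝓘(ℝ, E) 𝓘(ℝ, E') f.map (P.incl x) v := by
  have key : ∀ (q : N) (h : f.map (P.incl x) = q)
      (L : TangentSpace 𝓘(ℝ, E) (P.incl x) →L[ℝ] TangentSpace 𝓘(ℝ, E') (f.map (P.incl x))),
      ((h ▸ L : TangentSpace 𝓘(ℝ, E) (P.incl x) →L[ℝ] TangentSpace 𝓘(ℝ, E') q) v : E') =
        (L v : E') := by
    intro q h L; subst h; rfl
  exact key _ (f.comm x) _

variable [IsManifold 𝓘(ℝ, E₀) ∞ M₀] [IsManifold 𝓘(ℝ, E) ∞ M]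
  [IsManifold 𝓘(ℝ, E₀') ∞ N₀] [IsManifold 𝓘(ℝ, E') ∞ N]

/-- The map `f` in the charts of `M` and `N` that define the normal bundles. -/
def inCharts (x₀ : M₀) (y₀ : N₀) : E → E' := Q.chartM y₀ ∘ f.map ∘ (P.chartM x₀).symm

/-- The domain of `f.inCharts x₀ y₀`. -/
def inChartsSource (x₀ : M₀) (y₀ : N₀) : Set E :=
  (P.chartM x₀).target ∩ (P.chartM x₀).symm ⁻¹' (f.map ⁻¹' (Q.chartM y₀).source)

theorem isOpen_inChartsSource (x₀ : M₀) (y₀ : N₀) : IsOpen (f.inChartsSource x₀ y₀) :=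
  (P.chartM x₀).isOpen_inter_preimage_symm
    ((Q.chartM y₀).open_source.preimage f.contMDiff_map.continuous)

theorem chartM_incl_mem_inChartsSource {x₀ y : M₀} {y₀ : N₀} (hy : y ∈ (P.chartM₀ x₀).source)
    (hy' : f.map₀ y ∈ (Q.chartM₀ y₀).source) :
    P.chartM x₀ (P.incl y) ∈ f.inChartsSource x₀ y₀ := by
  refine ⟨(P.chartM x₀).map_source (P.incl_mem_source hy), ?_⟩
  change f.map ((P.chartM x₀).symm (P.chartM x₀ (P.incl y))) ∈ (Q.chartM y₀).source
  rw [(P.chartM x₀).left_inv (P.incl_mem_source hy), f.comm]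
  exact Q.incl_mem_source hy'

theorem contDiffOn_fderiv_inCharts (x₀ : M₀) (y₀ : N₀) :
    ContDiffOn ℝ ∞ (fderiv ℝ (f.inCharts x₀ y₀)) (f.inChartsSource x₀ y₀) := by
  refine ContDiffOn.fderiv_of_isOpen (n := ∞) ?_ (f.isOpen_inChartsSource x₀ y₀) (by simp)
  rw [← contMDiffOn_iff_contDiffOn]
  exact (contMDiffOn_of_mem_maximalAtlas (Q.chartM_mem y₀)).comp
    (f.contMDiff_map.comp_contMDiffOn
      ((contMDiffOn_symm_of_mem_maximalAtlas (P.chartM_mem x₀)).mono inter_subset_left))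
    fun z hz => hz.2

theorem chartDeriv_derivAt {x₀ y : M₀} {y₀ : N₀} (hy : y ∈ (P.chartM₀ x₀).source)
    (hy' : f.map₀ y ∈ (Q.chartM₀ y₀).source) (w : E) :
    chartDeriv (Q.chartM y₀) (Q.incl (f.map₀ y))
      (f.derivAt y (chartDerivSymm (P.chartM x₀) (P.incl y) w)) =
    fderiv ℝ (f.inCharts x₀ y₀) (P.chartM x₀ (P.incl y)) w := by
  have hi := P.incl_mem_source hy
  have hi' := Q.incl_mem_source hy'
  have h1 := (chart_mdifferentiable (P.chartM_mem x₀)).mdifferentiableAt_symm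
    ((P.chartM x₀).map_source hi)
  have hinv := (P.chartM x₀).left_inv hi
  have h2 : MDifferentiableAt 𝓘(ℝ, E) 𝓘(ℝ, E') f.map
      ((P.chartM x₀).symm (P.chartM x₀ (P.incl y))) :=
    (f.contMDiff_map _).mdifferentiableAt (by simp)
  have h3 : MDifferentiableAt 𝓘(ℝ, E') 𝓘(ℝ, E') (Q.chartM y₀)
      (f.map ((P.chartM x₀).symm (P.chartM x₀ (P.incl y)))) := by
    rw [hinv, f.comm]
    exact (chart_mdifferentiable (Q.chartM_mem y₀)).mdifferentiableAt hi'
  have h4 := mfderiv_comp _ h2 h1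
  have h5 := mfderiv_comp (f := f.map ∘ (P.chartM x₀).symm) (P.chartM x₀ (P.incl y)) h3
    (h2.comp _ h1)
  rw [h4, mfderiv_eq_fderiv] at h5
  -- With every tangent space read as the model space, the derivatives become functions of the base
  -- point, so equal base points can be exchanged.
  let D : N → E' →L[ℝ] E' := fun n => mfderiv 𝓘(ℝ, E') 𝓘(ℝ, E') (Q.chartM y₀) n
  let G : M → E →L[ℝ] E' := fun m => mfderiv 𝓘(ℝ, E) 𝓘(ℝ, E') f.map m
  let S : E →L[ℝ] E := chartDerivSymm (P.chartM x₀) (P.incl y)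
  have h6 : fderiv ℝ (f.inCharts x₀ y₀) (P.chartM x₀ (P.incl y)) w =
      D (f.map ((P.chartM x₀).symm (P.chartM x₀ (P.incl y))))
        (G ((P.chartM x₀).symm (P.chartM x₀ (P.incl y))) (S w)) :=
    congrArg (fun L : E →L[ℝ] E' => L w) h5
  rw [h6, hinv, f.comm]
  exact congrArg (D (Q.incl (f.map₀ y))) (f.derivAt_apply y _)

/-- A normal class may be represented by the vector with zero `E₀`-component. Hence `f_*` acts on
fibre coordinates by the `F → F'` block of the derivative of `f` in charts, which depends smoothly
on the base point. -/
theorem coord_normalSpaceMap {x₀ y : M₀} {y₀ : N₀} (hy : y ∈ (P.chartM₀ x₀).source)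
    (hy' : f.map₀ y ∈ (Q.chartM₀ y₀).source) (X : P.NormalSpace y) :
    Q.coord y₀ (f.map₀ y) (f.normalSpaceMap y X) =
      ((Q.split y₀).symm (fderiv ℝ (f.inCharts x₀ y₀) (P.chartM x₀ (P.incl y))
        (P.split x₀ (0, P.coord x₀ y X)))).2 := by
  conv_lhs => rw [← P.coordSymm_coord hy X]
  refine (Q.coord_mk hy' (f.derivAt y (P.preCoordSymm x₀ y (P.coord x₀ y X)))).trans ?_
  exact congrArg (fun u => ((Q.split y₀).symm u).2) (f.chartDeriv_derivAt hy hy' _)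

theorem contMDiff_normalMap :
    ContMDiff (𝓘(ℝ, E₀).prod 𝓘(ℝ, F)) (𝓘(ℝ, E₀').prod 𝓘(ℝ, F')) ∞ f.normalMap := by
  intro p
  have hπ : ContMDiff (𝓘(ℝ, E₀).prod 𝓘(ℝ, F)) 𝓘(ℝ, E₀) ∞ (π F P.NormalSpace) :=
    Bundle.contMDiff_proj P.NormalSpace
  refine Bundle.contMDiffAt_totalSpace.2 ⟨(f.contMDiff_map₀.comp hπ) p, ?_⟩
  set x₀ : M₀ := p.1
  set y₀ : N₀ := f.map₀ x₀
  let U : Set P.NormalBundle := π F P.NormalSpace ⁻¹'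
    ((P.chartM₀ x₀).source ∩ f.map₀ ⁻¹' (Q.chartM₀ y₀).source)
  have hU : IsOpen U := ((P.chartM₀ x₀).open_source.inter
    ((Q.chartM₀ y₀).open_source.preimage f.contMDiff_map₀.continuous)).preimage hπ.continuous
  have hpU : p ∈ U := ⟨P.mem_chartM₀_source x₀, Q.mem_chartM₀_source y₀⟩
  -- The fibre coordinate is the second component of the trivialization at `x₀`, so its smoothness
  -- is that of the identity of the bundle.
  have hcoord : ContMDiffAt (𝓘(ℝ, E₀).prod 𝓘(ℝ, F)) 𝓘(ℝ, F) ∞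
      (fun z : P.NormalBundle => P.coord x₀ z.1 z.2) p :=
    (Bundle.contMDiffAt_totalSpace.1 (contMDiffAt_id (x := p))).2
  have hfd : ContMDiffAt (𝓘(ℝ, E₀).prod 𝓘(ℝ, F)) 𝓘(ℝ, E →L[ℝ] E') ∞
      (fun z : P.NormalBundle => fderiv ℝ (f.inCharts x₀ y₀) (P.chartM x₀ (P.incl z.1))) p := by
    have h1 := f.contDiffOn_fderiv_inCharts x₀ y₀
    have h2 : ContMDiffAt 𝓘(ℝ, E₀) 𝓘(ℝ, E) ∞ (P.chartM x₀ ∘ P.incl) x₀ :=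
      (contMDiffAt_of_mem_maximalAtlas (P.chartM_mem x₀)
        (P.incl_mem_source hpU.1)).comp x₀ (P.contMDiff_incl x₀)
    have h3 := h1.contMDiffOn.contMDiffAt ((f.isOpen_inChartsSource x₀ y₀).mem_nhds
      (f.chartM_incl_mem_inChartsSource hpU.1 hpU.2))
    have h4 := h3.comp x₀ h2
    exact ContMDiffAt.comp (f := π F P.NormalSpace) p h4 (hπ p)
  have hlin : ContMDiffAt (𝓘(ℝ, E₀).prod 𝓘(ℝ, F)) 𝓘(ℝ, E) ∞
      (fun z : P.NormalBundle => P.split x₀ (0, P.coord x₀ z.1 z.2)) p :=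
    ((P.split x₀ : E₀ × F →L[ℝ] E).comp
      (ContinuousLinearMap.inr ℝ E₀ F)).contMDiff.contMDiffAt.comp p hcoord
  have h1 := ((ContinuousLinearMap.snd ℝ E₀' F').comp
    ((Q.split y₀).symm : E' →L[ℝ] E₀' × F')).contMDiff.contMDiffAt.comp (n := ∞) p
      (hfd.clm_apply hlin)
  refine h1.congr_of_eventuallyEq ?_
  filter_upwards [hU.mem_nhds hpU] with z hz
  exact f.coord_normalSpaceMap hz.1 hz.2 z.2

variable [CompleteSpace E] [CompleteSpace E'] {Z : Set N}

/-- This is `T f⁻¹(Z) = Df⁻¹(TZ)` at points of `M₀`, transported along `f.comm` to the base point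
used by `derivAt`. -/
theorem mem_tangentSub_preimage_iff (hZ : IsSubmanifold 𝓘(ℝ, E') Z)
    (hf : IsTransverse 𝓘(ℝ, E) 𝓘(ℝ, E') f.map Z) {x : M₀} (hx : Q.incl (f.map₀ x) ∈ Z)
    (v : TangentSpace 𝓘(ℝ, E) (P.incl x)) :
    v ∈ tangentSub 𝓘(ℝ, E) (f.map ⁻¹' Z) (P.incl x) ↔
      f.derivAt x v ∈ tangentSub 𝓘(ℝ, E') Z (Q.incl (f.map₀ x)) := by
  have key : ∀ (q : N) (h : f.map (P.incl x) = q)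
      (L : TangentSpace 𝓘(ℝ, E) (P.incl x) →L[ℝ] TangentSpace 𝓘(ℝ, E') (f.map (P.incl x))),
      L v ∈ tangentSub 𝓘(ℝ, E') Z (f.map (P.incl x)) ↔
      (h ▸ L : TangentSpace 𝓘(ℝ, E) (P.incl x) →L[ℝ] TangentSpace 𝓘(ℝ, E') q) v ∈
        tangentSub 𝓘(ℝ, E') Z q := by
    intro q h L; subst h; rfl
  rw [hf.tangentSub_preimage f.contMDiff_map hZ (by rwa [f.comm])]
  exact key _ (f.comm x) _

variable [CompleteSpace E₀']

/-- The preimage `f⁻¹(Z)` is transverse to `M₀`. -/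
theorem tangentRange_sup_tangentSub_preimage
    (hZ : IsSubmanifold 𝓘(ℝ, E') Z) (hQ : IsTransverse 𝓘(ℝ, E₀') 𝓘(ℝ, E') Q.incl Z)
    (hf : IsTransverse 𝓘(ℝ, E) 𝓘(ℝ, E') f.map Z)
    (hf₀ : IsTransverse 𝓘(ℝ, E₀) 𝓘(ℝ, E₀') f.map₀ (Q.incl ⁻¹' Z)) {x : M₀}
    (hx : Q.incl (f.map₀ x) ∈ Z) :
    P.tangentRange x ⊔ tangentSub 𝓘(ℝ, E) (f.map ⁻¹' Z) (P.incl x) = ⊤ := by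
  refine (Submodule.eq_top_iff').2 fun v => ?_
  -- Write `ι` for both inclusions. As `Z` is transverse to `N₀`, `Df(v) = Dι(u) + z` with `z ∈ TZ`;
  -- as `f₀` is transverse to `Z₀`, `u = Df₀(m) + z₀` with `z₀ ∈ TZ₀`. Then `Df(v - Dι(m)) = Dι(z₀)
  -- + z` lies in `TZ`, so `v - Dι(m)` is tangent to `f⁻¹(Z)`.
  have h1 : f.derivAt x v ∈ (mfderiv 𝓘(ℝ, E₀') 𝓘(ℝ, E') Q.incl (f.map₀ x)).range ⊔
      tangentSub 𝓘(ℝ, E') Z (Q.incl (f.map₀ x)) := by rw [(hQ _ hx).1]; trivial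
  obtain ⟨_, ⟨u, rfl⟩, z, hz, huz⟩ := Submodule.mem_sup.1 h1
  have h2 : u ∈ (mfderiv 𝓘(ℝ, E₀) 𝓘(ℝ, E₀') f.map₀ x).range ⊔
      tangentSub 𝓘(ℝ, E₀') (Q.incl ⁻¹' Z) (f.map₀ x) := by rw [(hf₀ x hx).1]; trivial
  obtain ⟨_, ⟨m, rfl⟩, z₀, hz₀, hmz⟩ := Submodule.mem_sup.1 h2
  rw [hQ.tangentSub_preimage Q.contMDiff_incl hZ hx] at hz₀
  refine Submodule.mem_sup.2 ⟨mfderiv 𝓘(ℝ, E₀) 𝓘(ℝ, E) P.incl x m, ⟨m, rfl⟩,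
    v - mfderiv 𝓘(ℝ, E₀) 𝓘(ℝ, E) P.incl x m, ?_, add_sub_cancel _ _⟩
  rw [f.mem_tangentSub_preimage_iff hZ hf hx, map_sub, f.derivAt_mfderiv_incl, ← huz, ← hmz]
  have h3 : mfderiv 𝓘(ℝ, E₀') 𝓘(ℝ, E') Q.incl (f.map₀ x) z₀ ∈
    tangentSub 𝓘(ℝ, E') Z (Q.incl (f.map₀ x)) := hz₀
  convert add_mem h3 hz using 1
  change mfderiv 𝓘(ℝ, E₀') 𝓘(ℝ, E') Q.incl (f.map₀ x)
    (mfderiv 𝓘(ℝ, E₀) 𝓘(ℝ, E₀') f.map₀ x m + z₀) + z -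
      mfderiv 𝓘(ℝ, E₀') 𝓘(ℝ, E') Q.incl (f.map₀ x) (mfderiv 𝓘(ℝ, E₀) 𝓘(ℝ, E₀') f.map₀ x m) = _
  rw [map_add]
  abel

/-- `T f₀⁻¹(Z₀) = T f⁻¹(Z) ∩ TM₀`. -/
theorem tangentSub_map₀_preimage [CompleteSpace E₀]
    (hZ : IsSubmanifold 𝓘(ℝ, E') Z) (hQ : IsTransverse 𝓘(ℝ, E₀') 𝓘(ℝ, E') Q.incl Z)
    (hf : IsTransverse 𝓘(ℝ, E) 𝓘(ℝ, E') f.map Z)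
    (hf₀ : IsTransverse 𝓘(ℝ, E₀) 𝓘(ℝ, E₀') f.map₀ (Q.incl ⁻¹' Z)) {x : M₀}
    (hx : Q.incl (f.map₀ x) ∈ Z) :
    tangentSub 𝓘(ℝ, E₀) (f.map₀ ⁻¹' (Q.incl ⁻¹' Z)) x =
      (tangentSub 𝓘(ℝ, E) (f.map ⁻¹' Z) (P.incl x)).comap
        (mfderiv 𝓘(ℝ, E₀) 𝓘(ℝ, E) P.incl x).toLinearMap := by
  have hZ₀ := hQ.isSubmanifold_preimage Q.contMDiff_incl hZ
  ext v
  -- Both sides are pullbacks of `TZ`, along `Df ∘ Dι` and `Dι ∘ Df₀`, which agree.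
  have h1 := f.mem_tangentSub_preimage_iff hZ hf hx (mfderiv 𝓘(ℝ, E₀) 𝓘(ℝ, E) P.incl x v)
  rw [f.derivAt_mfderiv_incl] at h1
  rw [hf₀.tangentSub_preimage f.contMDiff_map₀ hZ₀ hx,
    hQ.tangentSub_preimage Q.contMDiff_incl hZ hx]
  exact h1.symm

end BanachPair.Hom

end

theorem mainTheorem6
    {E₀ F E M₀ M E₀' F' E' N₀ N : Type*}
    [NormedAddCommGroup E₀] [NormedSpace ℝ E₀] [CompleteSpace E₀]
    [NormedAddCommGroup F] [NormedSpace ℝ F] [CompleteSpace F]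
    [NormedAddCommGroup E] [NormedSpace ℝ E] [CompleteSpace E]
    [TopologicalSpace M₀] [ChartedSpace E₀ M₀] [IsManifold 𝓘(ℝ, E₀) ∞ M₀]
    [TopologicalSpace M] [ChartedSpace E M] [IsManifold 𝓘(ℝ, E) ∞ M]
    [NormedAddCommGroup E₀'] [NormedSpace ℝ E₀'] [CompleteSpace E₀']
    [NormedAddCommGroup F'] [NormedSpace ℝ F'] [CompleteSpace F']
    [NormedAddCommGroup E'] [NormedSpace ℝ E'] [CompleteSpace E']
    [TopologicalSpace N₀] [ChartedSpace E₀' N₀] [IsManifold 𝓘(ℝ, E₀') ∞ N₀]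
    [TopologicalSpace N] [ChartedSpace E' N] [IsManifold 𝓘(ℝ, E') ∞ N] :
    -- the statement on normal bundles
    (∀ (P : BanachPair E₀ F E M₀ M) (Q : BanachPair E₀' F' E' N₀ N) (f : P.Hom Q)
      (Z : Set N) (Z₀ : Set N₀),
      IsSubmanifold 𝓘(ℝ, E') Z → IsTransverse 𝓘(ℝ, E₀') 𝓘(ℝ, E') Q.incl Z →
      Z₀ = Q.incl ⁻¹' Z →
      IsTransverse 𝓘(ℝ, E) 𝓘(ℝ, E') f.map Z →
      IsTransverse 𝓘(ℝ, E₀) 𝓘(ℝ, E₀') f.map₀ Z₀ →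
      -- the sets involved are submanifolds
      (IsSubmanifold 𝓘(ℝ, E₀') Z₀ ∧ IsSubmanifold 𝓘(ℝ, E) (f.map ⁻¹' Z) ∧
        IsSubmanifold 𝓘(ℝ, E₀) (f.map₀ ⁻¹' Z₀)) ∧
      -- `ν(Z, Z₀)` and `ν(f⁻¹(Z), f₀⁻¹(Z₀))` are submanifolds of `ν(N, N₀)` and `ν(M, M₀)`
      (Function.Injective (Q.subNormalIncl Z Z₀) ∧
        IsSubmanifold (𝓘(ℝ, E₀').prod 𝓘(ℝ, F')) (Set.range (Q.subNormalIncl Z Z₀))) ∧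
      (Function.Injective (P.subNormalIncl (f.map ⁻¹' Z) (f.map₀ ⁻¹' Z₀)) ∧
        IsSubmanifold (𝓘(ℝ, E₀).prod 𝓘(ℝ, F))
          (Set.range (P.subNormalIncl (f.map ⁻¹' Z) (f.map₀ ⁻¹' Z₀)))) ∧
      -- `f_*` is smooth and transverse to `ν(Z, Z₀)`
      ContMDiff (𝓘(ℝ, E₀).prod 𝓘(ℝ, F)) (𝓘(ℝ, E₀').prod 𝓘(ℝ, F')) ∞ f.normalMap ∧
      IsTransverse (𝓘(ℝ, E₀).prod 𝓘(ℝ, F)) (𝓘(ℝ, E₀').prod 𝓘(ℝ, F')) f.normalMap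
        (Set.range (Q.subNormalIncl Z Z₀)) ∧
      -- `f_*⁻¹(ν(Z, Z₀)) = ν(f⁻¹(Z), f₀⁻¹(Z₀))`
      f.normalMap ⁻¹' Set.range (Q.subNormalIncl Z Z₀) =
        Set.range (P.subNormalIncl (f.map ⁻¹' Z) (f.map₀ ⁻¹' Z₀))) ∧
    -- the corollary on tangent bundles
    (∀ (f : M → N) (Z : Set N), ContMDiff 𝓘(ℝ, E) 𝓘(ℝ, E') ∞ f → IsSubmanifold 𝓘(ℝ, E') Z →
      IsTransverse 𝓘(ℝ, E) 𝓘(ℝ, E') f Z →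
      IsSubmanifold 𝓘(ℝ, E) (f ⁻¹' Z) ∧
      IsSubmanifold 𝓘(ℝ, E').tangent (tangentSubset 𝓘(ℝ, E') Z) ∧
      IsTransverse 𝓘(ℝ, E).tangent 𝓘(ℝ, E').tangent (tangentMap 𝓘(ℝ, E) 𝓘(ℝ, E') f)
        (tangentSubset 𝓘(ℝ, E') Z) ∧
      tangentMap 𝓘(ℝ, E) 𝓘(ℝ, E') f ⁻¹' tangentSubset 𝓘(ℝ, E') Z =
        tangentSubset 𝓘(ℝ, E) (f ⁻¹' Z)) := by
  refine ⟨?_, fun f Z hf hZ h => ⟨h.isSubmanifold_preimage hf hZ, hZ.tangentSubset,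
    h.tangentMap hf hZ, h.tangentMap_preimage hf hZ⟩⟩
  rintro P Q f Z Z₀ hZ hQ rfl hf hf₀
  have hZ₀ := hQ.isSubmanifold_preimage Q.contMDiff_incl hZ
  have hS₀ := hf₀.isSubmanifold_preimage f.contMDiff_map₀ hZ₀
  have hrQ : range (Q.subNormalIncl Z (Q.incl ⁻¹' Z)) = π F' Q.NormalSpace ⁻¹' (Q.incl ⁻¹' Z) :=
    Q.range_subNormalIncl fun y hy => (hQ y hy).1
  have hrP : range (P.subNormalIncl (f.map ⁻¹' Z) (f.map₀ ⁻¹' (Q.incl ⁻¹' Z))) =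
      π F P.NormalSpace ⁻¹' (f.map₀ ⁻¹' (Q.incl ⁻¹' Z)) :=
    P.range_subNormalIncl fun x hx => f.tangentRange_sup_tangentSub_preimage hZ hQ hf hf₀ hx
  -- Both normal bundles are now full restrictions of bundles to subsets of the base, so the
  -- preimage formula holds by definition of `f_*`.
  rw [hrQ, hrP]
  exact ⟨⟨hZ₀, hf.isSubmanifold_preimage f.contMDiff_map hZ, hS₀⟩,
    ⟨Q.subNormalIncl_injective fun y hy => hQ.tangentSub_preimage Q.contMDiff_incl hZ hy,
      hZ₀.proj_preimage⟩,
    ⟨P.subNormalIncl_injective fun x hx => f.tangentSub_map₀_preimage hZ hQ hf hf₀ hx,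
      hS₀.proj_preimage⟩,
    f.contMDiff_normalMap,
    hf₀.proj_preimage f.contMDiff_map₀ f.contMDiff_normalMap (fun _ => rfl) hZ₀, rfl⟩
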